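/- Let $(X_k)_{k\ge 1}$ and $(Y_k)_{k\ge 1}$ be two independent, real-valued, stationary Gaussian processes with $\operatorname{E}X_1=\operatorname{E}Y_1=0$, $\operatorname{Var}X_1=\operatorname{Var}Y_1=1$ and, for all $k\ge 1$, $$\operatorname{Cov}(X_1,X_{1+k})=k^{-D_X}L_X(k),\qquad \operatorname{Cov}(Y_1,Y_{1+k})=k^{-D_Y}L_Y(k),$$ where $D_X,D_Y\in(0,1)$ and $L_X,L_Y$ are slowly varying at infinity (measurable and positive on a neighbourhood of infinity, with $L(ax)/L(x)\to1$ as $x\to\infty$ for every $a>0$). Let $\varphi_X(s)=\operatorname{E}e^{isX_1}$, $\varphi_Y(t)=\operatorname{E}e^{itY_1}$, $\varphi_X^{(n)}(s)=\frac1n\sum_{j=1}^n e^{isX_j}$, $\varphi_Y^{(n)}(t)=\frac1n\sum_{j=1}^n e^{itY_j}$, $\bar X_n=\frac1n\sum_{j=1}^nX_j$, $\bar Y_n=\frac1n\sum_{j=1}^nY_j$ and $J_1(s)=i\,s\,e^{-s^2/2}$. Fix $c>0$, let $\omega(s,t)=(c^2s^2t^2)^{-1}$, and let $\|f\|_2^2=\int_{\mathbb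 R}\int_{\mathbb R}|f(s,t)|^2\,\omega(s,t)\,ds\,dt$ be the norm of the complex Hilbert space $L^2(\mathbb R^2,\omega(s,t)\,ds\,dt)$. For every $n\ge1$ and every outcome, the function $(s,t)\mapsto(\varphi_Y^{(n)}(t)-\varphi_Y(t))(\varphi_X^{(n)}(s)-\varphi_X(s))$ belongs to $L^2(\mathbb R^2,\omega(s,t)\,ds\,dt)$, as does $J_1(s)J_1(t)$, and, as $n\to\infty$, $$\Bigl\|\bigl(\varphi_Y^{(n)}(t)-\varphi_Y(t)\bigr)\bigl(\varphi_X^{(n)}(s)-\varphi_X(s)\bigr)-J_1(s)\bar X_n\,J_1(t)\bar Y_n\Bigr\|_2=o_P\Bigl(n^{-\frac{D_X+D_Y}2}L_X^{1/2}(n)L_Y^{1/2}(n)\Bigr).$$ Moreover, $$n^{\frac{D_X+D_Y}2}L_X^{-1/2}(n)L_Y^{-1/2}(n)\bigl(\varphi_Y^{(n)}(t)-\varphi_Y(t)\bigr)\bigl(\varphi_X^{(n)}(s)-\varphi_X(s)\bigr)\ \longrightarrow\ -st\,e^{-\frac{s^2+t^2}2}\,\sigma_XZ_X\,\sigma_YZ_Y$$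 in distribution (weak convergence) in $L^2(\mathbb R^2,\omega(s,t)\,ds\,dt)$, where $Z_X,Z_Y$ are independent standard normal random variables and $$\sigma_X^2=\frac{2}{(1-D_X)(2-D_X)},\qquad \sigma_Y^2=\frac{2}{(1-D_Y)(2-D_Y)}.$$ -/

import Mathlib

open MeasureTheory ProbabilityTheory Filter Topology
open scoped ENNReal NNReal

namespace DistCov

/-- `L` is slowly varying at infinity: from some point on it is positive and measurable, and
`L (a x) / L x → 1` as `x → ∞` for every `a > 0`. -/
structure SlowlyVarying (L : ℝ → ℝ) : Prop where
  eventually_pos : ∀ᶠ x in atTop, 0 < L x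
  eventually_measurable : ∃ x₀ : ℝ, Measurable (fun x : Set.Ici x₀ => L x)
  tendsto_ratio : ∀ a : ℝ, 0 < a → Tendsto (fun x => L (a * x) / L x) atTop (𝓝 1)

/-- A time series is (second-order) stationary: its moments of order two are finite, its mean is
constant and `Cov(X_i, X_{i+k})` depends on the lag `k` only. For Gaussian processes this is
the same as strict stationarity. -/
structure IsStationary {Ω : Type*} [MeasurableSpace Ω] (P : Measure Ω) (X : ℕ → Ω → ℝ) :
    Prop where
  memLp_two : ∀ i, MemLp (X i) 2 P
  mean_eq : ∀ i, ∫ w, X i w ∂P = ∫ w, X 0 w ∂P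
  cov_eq : ∀ i k, cov[X i, X (i + k); P] = cov[X 0, X k; P]

/-- A real-valued stationary long-range dependent Gaussian process with mean `0`, variance `1`,
long-range dependence parameter `D ∈ (0,1)` and slowly varying function `L`.
The series `X_1, X_2, …` is indexed from zero here: `X j` stands for `X_{j+1}`. -/
structure IsStandardLRDGaussian {Ω : Type*} [MeasurableSpace Ω] (P : Measure Ω)
    (X : ℕ → Ω → ℝ) (D : ℝ) (L : ℝ → ℝ) : Prop where
  gaussian : IsGaussianProcess X P
  stationary : IsStationary P X
  mean_zero : ∫ w, X 0 w ∂P = 0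
  variance_one : Var[X 0; P] = 1
  param_pos : 0 < D
  param_lt_one : D < 1
  slowlyVarying : SlowlyVarying L
  cov_lag : ∀ k : ℕ, 1 ≤ k → cov[X 0, X k; P] = (k : ℝ) ^ (-D) * L k

/-- The sample mean of the first `n` observations. -/
noncomputable def sampleMean {Ω : Type*} (X : ℕ → Ω → ℝ) (n : ℕ) (w : Ω) : ℝ :=
  (∑ j ∈ Finset.range n, X j w) / n

/-- The empirical characteristic function of the first `n` observations. -/
noncomputable def empCharFun {Ω : Type*} (X : ℕ → Ω → ℝ) (n : ℕ) (w : Ω) (s : ℝ) : ℂ :=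
  (∑ j ∈ Finset.range n, Complex.exp (Complex.I * s * X j w)) / n

/-- The characteristic function of the (common) marginal distribution of the series. -/
noncomputable def marginalCharFun {Ω : Type*} [MeasurableSpace Ω] (P : Measure Ω)
    (X : ℕ → Ω → ℝ) (s : ℝ) : ℂ :=
  charFun (P.map (X 0)) s

/-- `(φ_Y^{(n)}(t) - φ_Y(t)) (φ_X^{(n)}(s) - φ_X(s))` as a function of `(s, t)`. -/
noncomputable def ecfProduct {Ω : Type*} [MeasurableSpace Ω] (P : Measure Ω)
    (X Y : ℕ → Ω → ℝ) (n : ℕ) (w : Ω) (p : ℝ × ℝ) : ℂ :=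
  (empCharFun Y n w p.2 - marginalCharFun P Y p.2) *
    (empCharFun X n w p.1 - marginalCharFun P X p.1)

/-- `J₁(s) = i s exp(-s²/2)`. -/
noncomputable def J₁ (s : ℝ) : ℂ :=
  Complex.I * (Real.exp (-s ^ 2 / 2) : ℂ) * s

/-- The measure `ω(s,t) ds dt` on the plane with `ω(s,t) = (c² s² t²)⁻¹`. -/
noncomputable def weightMeasure (c : ℝ) : Measure (ℝ × ℝ) :=
  volume.withDensity (fun p => ENNReal.ofReal ((c ^ 2 * p.1 ^ 2 * p.2 ^ 2)⁻¹))

/-- The Hilbert space `L²(ℝ², ω(s,t) ds dt)` of complex-valued functions, with its Borel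
`σ`-algebra. -/
abbrev L2Weight (c : ℝ) : Type := Lp ℂ 2 (weightMeasure c)

noncomputable instance instMeasurableSpaceL2Weight (c : ℝ) : MeasurableSpace (L2Weight c) := borel _

instance instBorelSpaceL2Weight (c : ℝ) : BorelSpace (L2Weight c) := ⟨rfl⟩

open Classical in
/-- The class of `f` in `L²(ω)`; it is only meaningful when `f` is square-integrable
(and is set to `0` otherwise). -/
noncomputable def toL2 (c : ℝ) (f : ℝ × ℝ → ℂ) : L2Weight c :=
  if h : MemLp f 2 (weightMeasure c) then h.toLp f else 0

/-- `R_n = o_P(a_n)` for nonnegative random quantities `R_n` and (eventually positive) numbers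
`a_n`: for every `ε > 0`, the probability of `R_n ≥ ε a_n` tends to zero. -/
def IsLittleOP {Ω : Type*} [MeasurableSpace Ω] (P : Measure Ω) (R : ℕ → Ω → ℝ≥0∞)
    (a : ℕ → ℝ) : Prop :=
  ∀ ε : ℝ, 0 < ε → Tendsto (fun n => P {w | ENNReal.ofReal (ε * a n) ≤ R n w}) atTop (𝓝 0)

/-- The limiting variance `2 / ((1 - D) (2 - D))` of `n^{D/2} L(n)^{-1/2}` times the sample
mean. -/
noncomputable def limitVar (D : ℝ) : ℝ := 2 / ((1 - D) * (2 - D))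

end DistCov

/-!
Everything happens in `L²` of a product measure: `weightMeasure c` is the square of
`lineWeight c = (c s²)⁻¹ ds`, so the norm of a tensor product is the product of the norms. Write
`A`, `B` for the centred empirical characteristic functions of `X`, `Y`, write
`a = J₁ · (mean of X)`, `b = J₁ · (mean of Y)` for their first-order Hermite terms, and put
`α = A - a`, `β = B - b`. Then `A ⊗ B - a ⊗ b = α ⊗ β + α ⊗ b + a ⊗ β`, and by the
Cauchy–Schwarz and Markov inequalities the reduction follows from `E‖α‖² = o(n ^ (-D) L n)` and
`E‖a‖² = O(n ^ (-D) L n)`.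

For `α`, the Hermite remainders of a standard Gaussian pair with correlation `ρ` have covariance
`exp (-s²) (exp (s² ρ) - 1 - s² ρ)` (`integral_hermiteRemainder_mul_conj`), which is at most
`ρ² min(1, s²)` (`remainderCov_le`). Hence `E‖α‖²` is bounded by a constant times
`n⁻² ∑ᵢⱼ r(|i - j|)²`, where `r` is the autocovariance, and this is negligible because `r → 0` while
`∑ |r|` diverges (`tendsto_sum_sum_autocov_sq`). For `a`, the variance of the sample mean is
asymptotic to `limitVar D · n ^ (-D) L n`: this is Karamata's theorem for sums
(`SlowlyVarying.tendsto_sum_div`), applied twice (`tendsto_sum_sum_autocov`). Karamata's theorem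
follows from Potter's bounds, and these from the uniform convergence theorem for slowly varying
functions (`eventually_forall_abs_sub_le`), the only place where their measurability matters.

For the weak convergence, the pair of sample means is an independent pair of centred Gaussian
variables, so the normalized product of the means times `J₁ ⊗ J₁` has *exactly* the law of
`κₙ Z_X Z_Y · (J₁ ⊗ J₁)` with constants `κₙ → √(limitVar D_X) √(limitVar D_Y)`. The latter
converges at every outcome, and the reduction transfers the convergence in distribution to the
product of empirical characteristic functions.
-/

namespace DistCov

/-! ### Slowly varying functions -/

/-- The additive form of the uniform convergence theorem for slowly varying functions. If it
failed along `x n`, `u n`, pointwise convergence would give convergence in measure of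
`t ↦ g (x n + t) - g (x n)` and of `t ↦ g (x n + u n + t) - g (x n + u n)` on bounded intervals,
and a common good point `x n + t` would link `g (x n + u n)` to `g (x n)`. -/
lemma eventually_forall_abs_sub_le {g : ℝ → ℝ} (hg : Measurable g)
    (h : ∀ u, Tendsto (fun x => g (x + u) - g x) atTop (𝓝 0)) {ε : ℝ} (hε : 0 < ε) :
    ∀ᶠ x in atTop, ∀ u ∈ Set.Icc (0 : ℝ) 1, |g (x + u) - g x| ≤ ε := by
  by_contra hcon
  have hfr : ∃ᶠ x in atTop, ∃ u ∈ Set.Icc (0 : ℝ) 1, ε < |g (x + u) - g x| := by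
    refine (not_eventually.1 hcon).mono fun x hx => ?_
    push Not at hx
    exact hx
  obtain ⟨x, hx, hxu⟩ := exists_seq_forall_of_frequently hfr
  choose u hu hgu using hxu
  have hxu : Tendsto (fun n => x n + u n) atTop atTop :=
    tendsto_atTop_mono (fun n => le_add_of_nonneg_right (hu n).1) hx
  set μ : Measure ℝ := volume.restrict (Set.Icc (-1) 1) with hμ
  have key : ∀ y : ℕ → ℝ, Tendsto y atTop atTop →
      ∀ᶠ n in atTop, μ {t | ε / 2 ≤ |g (y n + t) - g (y n)|} < 1 / 2 := by
    intro y hy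
    have hm : TendstoInMeasure μ (fun n t => g (y n + t) - g (y n)) atTop (fun _ => (0 : ℝ)) := by
      refine tendstoInMeasure_of_tendsto_ae (fun n => ?_) (ae_of_all _ fun t => ?_)
      · exact ((hg.comp (measurable_const_add _)).sub_const _).aestronglyMeasurable
      · exact (h t).comp hy
    rw [tendstoInMeasure_iff_norm] at hm
    have := hm (ε / 2) (by positivity)
    filter_upwards [this.eventually_lt_const (show (0 : ℝ≥0∞) < 1 / 2 by simp)] with n hn
    simpa [Real.norm_eq_abs] using hn
  obtain ⟨n, h1, h2⟩ := ((key x hx).and (key _ hxu)).exists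
  -- the two exceptional sets, the second one translated by `u n`, cannot cover `[0, 1]`
  have hB1 : volume (Set.Icc (0 : ℝ) 1 ∩ {t | ε / 2 ≤ |g (x n + t) - g (x n)|}) < 1 / 2 := by
    refine lt_of_le_of_lt ?_ h1
    rw [hμ, Measure.restrict_apply' measurableSet_Icc, Set.inter_comm]
    exact measure_mono (Set.inter_subset_inter_right _ (Set.Icc_subset_Icc (by norm_num) le_rfl))
  have hB2 : volume (Set.Icc (0 : ℝ) 1 ∩
      {t | ε / 2 ≤ |g (x n + u n + (t - u n)) - g (x n + u n)|}) < 1 / 2 := by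
    refine lt_of_le_of_lt ?_ h2
    rw [hμ, Measure.restrict_apply' measurableSet_Icc,
      ← measure_preimage_add_right volume (u n)]
    refine measure_mono fun t ht => ⟨?_, ?_, ?_⟩
    · have h3 : ε / 2 ≤ |g (x n + u n + (t + u n - u n)) - g (x n + u n)| := ht.2
      rwa [add_sub_cancel_right] at h3
    · have h3 : 0 ≤ t + u n := ht.1.1
      linarith [(hu n).2]
    · have h3 : t + u n ≤ 1 := ht.1.2
      linarith [(hu n).1]
  have hne : ¬ Set.Icc (0 : ℝ) 1 ⊆
      (Set.Icc (0 : ℝ) 1 ∩ {t | ε / 2 ≤ |g (x n + t) - g (x n)|}) ∪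
      (Set.Icc (0 : ℝ) 1 ∩ {t | ε / 2 ≤ |g (x n + u n + (t - u n)) - g (x n + u n)|}) := by
    intro hsub
    have h3 := (measure_mono hsub).trans (measure_union_le (μ := volume) _ _)
    have h4 := h3.trans_lt (ENNReal.add_lt_add hB1 hB2)
    rw [Real.volume_Icc, ENNReal.add_halves] at h4
    simp at h4
  obtain ⟨t, ht, htn⟩ := Set.not_subset.1 hne
  simp only [Set.mem_union, Set.mem_inter_iff, ht, true_and, Set.mem_ofPred_eq, not_or,
    not_le] at htn
  have h5 : x n + u n + (t - u n) = x n + t := by ring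
  rw [h5] at htn
  have := hgu n
  have h6 := abs_sub_le (g (x n + u n)) (g (x n + t)) (g (x n))
  rw [abs_sub_comm (g (x n + u n)) (g (x n + t))] at h6
  linarith [htn.1, htn.2]

/-- A version of Potter's bounds. -/
lemma SlowlyVarying.exists_abs_log_sub_le {L : ℝ → ℝ} (hL : SlowlyVarying L) {ε : ℝ}
    (hε : 0 < ε) :
    ∃ N : ℝ, 0 < N ∧ (∀ x, N ≤ x → 0 < L x) ∧ ∀ x y, N ≤ x → x ≤ y →
      |Real.log (L y) - Real.log (L x)| ≤ ε * (Real.log (y / x) + 1) := by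
  obtain ⟨x₁, hpos⟩ := eventually_atTop.1 hL.eventually_pos
  obtain ⟨x₀, hmeas⟩ := hL.eventually_measurable
  -- `L` is modified below `x₀` to become measurable
  set M : ℝ → ℝ := (Set.Ici x₀).indicator L with hM
  have hMm : Measurable M := by
    refine measurable_of_restrict_of_restrict_compl (s := Set.Ici x₀) measurableSet_Ici ?_ ?_
    · convert! hmeas using 2 with x
      exact Set.indicator_of_mem x.2 L
    · convert! (measurable_const : Measurable fun _ : ↥(Set.Ici x₀)ᶜ => (0 : ℝ)) using 2 with x
      exact Set.indicator_of_notMem x.2 L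
  set g : ℝ → ℝ := fun x => Real.log (M (Real.exp x)) with hgdef
  have hg : Measurable g := Real.measurable_log.comp (hMm.comp Real.measurable_exp)
  have hgL : ∀ᶠ x in atTop, g x = Real.log (L (Real.exp x)) := by
    filter_upwards [Real.tendsto_exp_atTop.eventually (eventually_ge_atTop x₀)] with x hx
    simp only [hgdef, hM, Set.indicator_of_mem (Set.mem_Ici.2 hx)]
  have hLp : ∀ᶠ x in atTop, 0 < L (Real.exp x) := Real.tendsto_exp_atTop.eventually
    hL.eventually_pos
  have hlim : ∀ u, Tendsto (fun x => g (x + u) - g x) atTop (𝓝 0) := by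
    intro u
    have h1 := (hL.tendsto_ratio (Real.exp u) (Real.exp_pos u)).comp Real.tendsto_exp_atTop
    have h2 := (Real.continuousAt_log one_ne_zero).tendsto.comp h1
    rw [Real.log_one] at h2
    have ht : Tendsto (fun x : ℝ => x + u) atTop atTop :=
      tendsto_atTop_add_const_right _ _ tendsto_id
    refine h2.congr' ?_
    filter_upwards [hgL, hLp, ht.eventually hgL, ht.eventually hLp] with x a b c d
    rw [a, c, ← Real.log_div d.ne' b.ne']
    simp only [Function.comp_apply, Real.exp_add, mul_comm]
  obtain ⟨X₀, hX₀⟩ := eventually_atTop.1 ((eventually_forall_abs_sub_le hg hlim hε).and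
    (hgL.and hLp))
  have hstep : ∀ n : ℕ, ∀ x y, X₀ ≤ x → x ≤ y → y ≤ x + n → |g y - g x| ≤ ε * n := by
    intro n
    induction n with
    | zero =>
      intro x y _ h1 h2
      have : y = x := le_antisymm (by simpa using h2) h1
      simp [this]
    | succ n ih =>
      intro x y hx h1 h2
      push_cast at h2 ⊢
      rcases le_total y (x + n) with h3 | h3
      · have := ih x y hx h1 h3
        linarith
      · have h4 := ih x (x + n) hx (by simp) le_rfl
        have h5 := (hX₀ (x + n) (by have : (0:ℝ) ≤ n := n.cast_nonneg
                                    linarith)).1 (y - (x + n)) ⟨by linarith, by linarith⟩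
        rw [add_sub_cancel] at h5
        have := abs_sub_le (g y) (g (x + n)) (g x)
        linarith
  refine ⟨Real.exp X₀, Real.exp_pos _, fun x hx => ?_, fun x y hx hxy => ?_⟩
  · have hx0 := (Real.exp_pos X₀).trans_le hx
    have := (hX₀ (Real.log x) ((Real.le_log_iff_exp_le hx0).2 hx)).2.2
    rwa [Real.exp_log hx0] at this
  · have hx0 := (Real.exp_pos X₀).trans_le hx
    have hy0 := hx0.trans_le hxy
    have hx1 := (Real.le_log_iff_exp_le hx0).2 hx
    have hxy1 := Real.log_le_log hx0 hxy
    have e1 := (hX₀ _ hx1).2.1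
    have e2 := (hX₀ _ (hx1.trans hxy1)).2.1
    rw [Real.exp_log hx0] at e1
    rw [Real.exp_log hy0] at e2
    rw [← e1, ← e2, Real.log_div hy0.ne' hx0.ne']
    refine (hstep ⌈Real.log y - Real.log x⌉₊ _ _ hx1 hxy1 ?_).trans ?_
    · linarith [Nat.le_ceil (Real.log y - Real.log x)]
    · exact mul_le_mul_of_nonneg_left (Nat.ceil_lt_add_one (by linarith)).le hε.le

/-- Potter's bounds, in the form used to compare terms with index `k ≤ n`. -/
lemma SlowlyVarying.exists_ratio_bounds {L : ℝ → ℝ} (hL : SlowlyVarying L) {ε : ℝ}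
    (hε : 0 < ε) :
    ∃ N : ℝ, 0 < N ∧ (∀ x, N ≤ x → 0 < L x) ∧ ∀ x y, N ≤ x → x ≤ y →
      L x ≤ Real.exp ε * (x / y) ^ (-ε) * L y ∧ Real.exp (-ε) * (x / y) ^ ε * L y ≤ L x := by
  obtain ⟨N, hN, hpos, hlog⟩ := hL.exists_abs_log_sub_le hε
  refine ⟨N, hN, hpos, fun x y hx hxy => ?_⟩
  have hx0 := hN.trans_le hx
  have hy0 := hx0.trans_le hxy
  have hLx := hpos x hx
  have hLy := hpos y (hx.trans hxy)
  have h := abs_le.1 (hlog x y hx hxy)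
  rw [Real.log_div hy0.ne' hx0.ne'] at h
  rw [Real.rpow_def_of_pos (div_pos hx0 hy0), Real.rpow_def_of_pos (div_pos hx0 hy0),
    Real.log_div hx0.ne' hy0.ne', ← Real.exp_add, ← Real.exp_add]
  nth_rewrite 1 [← Real.exp_log hLx]
  nth_rewrite 2 [← Real.exp_log hLx]
  nth_rewrite 1 2 [← Real.exp_log hLy]
  rw [← Real.exp_add, ← Real.exp_add, Real.exp_le_exp, Real.exp_le_exp]
  constructor <;> nlinarith [h.1, h.2]

lemma SlowlyVarying.tendsto_rpow_mul_atTop {L : ℝ → ℝ} (hL : SlowlyVarying L) {β : ℝ}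
    (hβ : 0 < β) : Tendsto (fun n : ℕ => (n : ℝ) ^ β * L n) atTop atTop := by
  obtain ⟨N, hN, hpos, hb⟩ := hL.exists_ratio_bounds (half_pos hβ)
  have hC : 0 < L N * Real.exp (-(β / 2)) * N ^ (β / 2) := by
    have := hpos N le_rfl
    positivity
  have h1 : Tendsto (fun n : ℕ => L N * Real.exp (-(β / 2)) * N ^ (β / 2) * (n : ℝ) ^ (β / 2))
      atTop atTop := by
    refine Tendsto.const_mul_atTop hC ?_
    exact (tendsto_rpow_atTop (half_pos hβ)).comp tendsto_natCast_atTop_atTop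
  refine tendsto_atTop_mono' _ ?_ h1
  filter_upwards [tendsto_natCast_atTop_atTop.eventually (eventually_ge_atTop N)] with n hn
  have hn0 : (0 : ℝ) < n := hN.trans_le hn
  have h2 := (hb N n le_rfl hn).1
  have h3 : (n : ℝ) ^ β = (n : ℝ) ^ (β / 2) * (n : ℝ) ^ (β / 2) := by
    rw [← Real.rpow_add hn0, add_halves]
  have h4 : (N / n : ℝ) ^ (-(β / 2)) * N ^ (β / 2) = (n : ℝ) ^ (β / 2) := by
    rw [Real.div_rpow hN.le hn0.le, Real.rpow_neg hN.le, Real.rpow_neg hn0.le]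
    have := (Real.rpow_pos_of_pos hN (β / 2)).ne'
    field_simp
  calc L N * Real.exp (-(β / 2)) * N ^ (β / 2) * (n : ℝ) ^ (β / 2)
      ≤ (Real.exp (β / 2) * (N / n : ℝ) ^ (-(β / 2)) * L n) * Real.exp (-(β / 2)) * N ^ (β / 2)
        * (n : ℝ) ^ (β / 2) := by gcongr
    _ = (Real.exp (β / 2) * Real.exp (-(β / 2))) * ((N / n : ℝ) ^ (-(β / 2)) * N ^ (β / 2))
        * L n * (n : ℝ) ^ (β / 2) := by ring
    _ = (n : ℝ) ^ β * L n := by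
      rw [h4, ← Real.exp_add, add_neg_cancel, Real.exp_zero, h3]; ring

/-! ### Sums of regularly varying sequences -/

/-- A Stolz–Cesàro argument: the summands are compared with the increments of `n ^ (γ + 1)`. -/
lemma tendsto_sum_rpow_div {γ : ℝ} (hγ : -1 < γ) :
    Tendsto (fun n : ℕ => (∑ k ∈ Finset.range n, (k : ℝ) ^ γ) / (n : ℝ) ^ (γ + 1)) atTop
      (𝓝 (1 / (γ + 1))) := by
  have hγ1 : 0 < γ + 1 := by linarith
  set g : ℕ → ℝ := fun k => ((k + 1 : ℕ) : ℝ) ^ (γ + 1) - (k : ℝ) ^ (γ + 1) with hg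
  have hg0 : 0 ≤ g := fun k => sub_nonneg.2 <|
    Real.rpow_le_rpow (Nat.cast_nonneg k) (by simp) hγ1.le
  have hsum : ∀ n, ∑ k ∈ Finset.range n, g k = (n : ℝ) ^ (γ + 1) := fun n => by
    rw [hg, Finset.sum_range_sub (fun k : ℕ => (k : ℝ) ^ (γ + 1))]
    simp [Real.zero_rpow hγ1.ne']
  have hpow : Tendsto (fun n : ℕ => (n : ℝ) ^ (γ + 1)) atTop atTop :=
    (tendsto_rpow_atTop hγ1).comp tendsto_natCast_atTop_atTop
  -- `g k / k ^ γ` is a difference quotient of `x ↦ x ^ (γ + 1)` at `1`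
  have hratio : Tendsto (fun k : ℕ => g k / (k : ℝ) ^ γ) atTop (𝓝 (γ + 1)) := by
    have hd : HasDerivAt (fun x : ℝ => x ^ (γ + 1)) (γ + 1) 1 := by
      simpa using Real.hasDerivAt_rpow_const (x := 1) (p := γ + 1) (Or.inl one_ne_zero)
    have hs := hd.tendsto_slope_zero
    have hk : Tendsto (fun k : ℕ => ((k : ℝ))⁻¹) atTop (𝓝[≠] 0) := by
      refine tendsto_nhdsWithin_iff.2 ⟨tendsto_inv_atTop_nhds_zero_nat, ?_⟩
      filter_upwards [eventually_gt_atTop 0] with k hk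
      simp [hk.ne']
    refine (hs.comp hk).congr' ?_
    filter_upwards [eventually_gt_atTop 0] with k hk
    have hk0 : (0 : ℝ) < k := by exact_mod_cast hk
    have h1 : (1 + (k : ℝ)⁻¹) = ((k + 1 : ℕ) : ℝ) / k := by push_cast; field_simp
    simp only [Function.comp_apply, hg, inv_inv, Real.one_rpow, smul_eq_mul]
    rw [h1, Real.div_rpow (by positivity) hk0.le, Real.rpow_add_one hk0.ne']
    have := (Real.rpow_pos_of_pos hk0 γ).ne'
    field_simp
  have hlo : (fun k : ℕ => (k : ℝ) ^ γ - 1 / (γ + 1) * g k) =o[atTop] g := by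
    have hgpos : ∀ᶠ k in atTop, g k ≠ 0 := by
      filter_upwards [hratio.eventually_ne hγ1.ne'] with k hk h0
      simp [h0] at hk
    rw [Asymptotics.isLittleO_iff_tendsto' (hgpos.mono fun k hk h0 => absurd h0 hk)]
    have h2 : Tendsto (fun k : ℕ => (g k / (k : ℝ) ^ γ)⁻¹ - 1 / (γ + 1)) atTop (𝓝 0) := by
      simpa using (hratio.inv₀ hγ1.ne').sub_const (1 / (γ + 1))
    refine h2.congr' ?_
    filter_upwards [hgpos] with k hk
    rw [inv_div, sub_div, mul_div_assoc, div_self hk, mul_one]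
  have hs := hlo.sum_range hg0 (by simpa only [hsum] using hpow)
  simp only [hsum, Finset.sum_sub_distrib, ← Finset.mul_sum] at hs
  have ht := hs.tendsto_div_nhds_zero.add_const (1 / (γ + 1))
  rw [zero_add] at ht
  refine ht.congr' ?_
  filter_upwards [hpow.eventually_gt_atTop 0] with n hn
  rw [sub_div, mul_div_assoc, div_self hn.ne']
  ring

/-- Karamata's theorem for sums: a sequence asymptotic to `A n ^ β L n` with `β > -1` and `A > 0`
has partial sums asymptotic to `A / (β + 1) n ^ (β + 1) L n`. Potter's bounds squeeze the sums
between multiples of sums of powers with exponents `β ± ε`. -/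
lemma SlowlyVarying.tendsto_sum_div {L : ℝ → ℝ} (hL : SlowlyVarying L) {β A : ℝ}
    (hβ : -1 < β) (hA : 0 < A) {a : ℕ → ℝ}
    (ha : Tendsto (fun n : ℕ => a n / ((n : ℝ) ^ β * L n)) atTop (𝓝 A)) :
    Tendsto (fun n : ℕ => (∑ k ∈ Finset.range n, a k) / ((n : ℝ) ^ (β + 1) * L n)) atTop
      (𝓝 (A / (β + 1))) := by
  have hβ1 : 0 < β + 1 := by linarith
  -- the sum over `k` between `N` and `n` is all that matters
  have hnorm := hL.tendsto_rpow_mul_atTop hβ1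
  have hbd : ∀ (γ C : ℝ) (N : ℕ), -1 < γ → Tendsto (fun n : ℕ =>
      (∑ k ∈ Finset.range N, a k) / ((n : ℝ) ^ (β + 1) * L n) + C *
        ((∑ k ∈ Finset.range n, (k : ℝ) ^ γ) / (n : ℝ) ^ (γ + 1)
          - (∑ k ∈ Finset.range N, (k : ℝ) ^ γ) / (n : ℝ) ^ (γ + 1))) atTop
      (𝓝 (C / (γ + 1))) := by
    intro γ C N hγ
    have h1 : Tendsto (fun n : ℕ => (n : ℝ) ^ (γ + 1)) atTop atTop :=
      (tendsto_rpow_atTop (by linarith)).comp tendsto_natCast_atTop_atTop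
    have := (hnorm.const_div_atTop (∑ k ∈ Finset.range N, a k)).add
      (((tendsto_sum_rpow_div hγ).sub
        (h1.const_div_atTop (∑ k ∈ Finset.range N, (k : ℝ) ^ γ))).const_mul C)
    simpa [div_eq_mul_inv] using this
  have hsplit : ∀ (b : ℕ → ℝ) {N n : ℕ}, N ≤ n →
      ∑ k ∈ Finset.range n, b k = ∑ k ∈ Finset.range N, b k + ∑ k ∈ Finset.Ico N n, b k :=
    fun b N n h => (Finset.sum_range_add_sum_Ico b h).symm
  have hpw : ∀ (γ : ℝ) {k n : ℕ} (C : ℝ), 0 < n → 0 < L n →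
      C * ((k : ℝ) ^ γ / (n : ℝ) ^ (γ + 1)) * ((n : ℝ) ^ (β + 1) * L n) =
        C * (n : ℝ) ^ β * ((k : ℝ) / n) ^ γ * L n := by
    intro γ k n C hn hLn
    have hn0 : (0 : ℝ) < n := by exact_mod_cast hn
    rw [Real.div_rpow (Nat.cast_nonneg k) hn0.le, Real.rpow_add_one hn0.ne',
      Real.rpow_add_one hn0.ne']
    have := (Real.rpow_pos_of_pos hn0 γ).ne'
    field_simp
  rw [tendsto_order]
  constructor
  · intro c hc
    have hcont : Tendsto (fun ε : ℝ => (A - ε) * Real.exp (-ε) / (β + ε + 1)) (𝓝[>] 0)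
        (𝓝 (A / (β + 1))) := by
      have : ContinuousAt (fun ε : ℝ => (A - ε) * Real.exp (-ε) / (β + ε + 1)) 0 := by
        refine ContinuousAt.div (by fun_prop) (by fun_prop) (by simpa using hβ1.ne')
      simpa using this.tendsto.mono_left nhdsWithin_le_nhds
    obtain ⟨ε, hεc, hε0, hεA⟩ := ((hcont.eventually_const_lt hc).and
      (Ioo_mem_nhdsGT hA)).exists
    obtain ⟨N₀, hN₀, hpos, hb⟩ := hL.exists_ratio_bounds hε0
    obtain ⟨N₁, hN₁⟩ := eventually_atTop.1 (ha.eventually_const_lt (show A - ε < A by linarith))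
    set N := max ⌈N₀⌉₊ N₁
    have hNN : ∀ k : ℕ, N ≤ k → N₀ ≤ k := fun k hk =>
      (Nat.le_ceil N₀).trans (by exact_mod_cast (le_max_left _ _).trans hk)
    filter_upwards [(hbd (β + ε) ((A - ε) * Real.exp (-ε)) N (by linarith)).eventually_const_lt
      hεc, eventually_ge_atTop N] with n hn hNn
    refine hn.trans_le ?_
    have hn0 : (0 : ℝ) < n := hN₀.trans_le (hNN n hNn)
    have hLn := hpos n (hNN n hNn)
    rw [hsplit a hNn, hsplit (fun k => (k : ℝ) ^ (β + ε)) hNn, ← sub_div,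
      add_sub_cancel_left, add_div]
    gcongr
    rw [le_div_iff₀ (by positivity), Finset.sum_div, Finset.mul_sum, Finset.sum_mul]
    refine Finset.sum_le_sum fun k hk => ?_
    rw [Finset.mem_Ico] at hk
    have hk0 : (0 : ℝ) < k := hN₀.trans_le (hNN k hk.1)
    have hLk := hpos k (hNN k hk.1)
    rw [hpw _ _ (by exact_mod_cast hn0) hLn]
    have h1 := hN₁ k ((le_max_right _ _).trans hk.1)
    rw [lt_div_iff₀ (by positivity)] at h1
    have h2 := (hb k n (hNN k hk.1) (by exact_mod_cast hk.2.le)).2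
    refine le_trans ?_ h1.le
    have hq : (0 : ℝ) < (k : ℝ) / n := by positivity
    have h3 : (n : ℝ) ^ β * ((k : ℝ) / n) ^ β = (k : ℝ) ^ β := by
      rw [Real.div_rpow hk0.le hn0.le]; field_simp
    rw [Real.rpow_add hq, ← h3]
    have hAε : 0 < A - ε := by linarith [hεA]
    calc (A - ε) * Real.exp (-ε) * (n : ℝ) ^ β * (((k : ℝ) / n) ^ β * ((k : ℝ) / n) ^ ε) * L n
        = (A - ε) * ((n : ℝ) ^ β * ((k : ℝ) / n) ^ β *
          (Real.exp (-ε) * ((k : ℝ) / n) ^ ε * L n)) := by ring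
      _ ≤ (A - ε) * ((n : ℝ) ^ β * ((k : ℝ) / n) ^ β * L k) := by gcongr
  · intro c hc
    have hcont : Tendsto (fun ε : ℝ => (A + ε) * Real.exp ε / (β - ε + 1)) (𝓝[>] 0)
        (𝓝 (A / (β + 1))) := by
      have : ContinuousAt (fun ε : ℝ => (A + ε) * Real.exp ε / (β - ε + 1)) 0 := by
        refine ContinuousAt.div (by fun_prop) (by fun_prop) (by simpa using hβ1.ne')
      simpa using this.tendsto.mono_left nhdsWithin_le_nhds
    obtain ⟨ε, hεc, hε0, hεA⟩ := ((hcont.eventually_lt_const hc).and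
      (Ioo_mem_nhdsGT hβ1)).exists
    obtain ⟨N₀, hN₀, hpos, hb⟩ := hL.exists_ratio_bounds hε0
    obtain ⟨N₁, hN₁⟩ := eventually_atTop.1 (ha.eventually_lt_const (show A < A + ε by linarith))
    set N := max ⌈N₀⌉₊ N₁
    have hNN : ∀ k : ℕ, N ≤ k → N₀ ≤ k := fun k hk =>
      (Nat.le_ceil N₀).trans (by exact_mod_cast (le_max_left _ _).trans hk)
    filter_upwards [(hbd (β - ε) ((A + ε) * Real.exp ε) N
      (by linarith)).eventually_lt_const hεc, eventually_ge_atTop N] with n hn hNn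
    refine lt_of_le_of_lt ?_ hn
    have hn0 : (0 : ℝ) < n := hN₀.trans_le (hNN n hNn)
    have hLn := hpos n (hNN n hNn)
    rw [hsplit a hNn, hsplit (fun k => (k : ℝ) ^ (β - ε)) hNn, ← sub_div,
      add_sub_cancel_left, add_div]
    gcongr
    rw [div_le_iff₀ (by positivity), Finset.sum_div, Finset.mul_sum, Finset.sum_mul]
    refine Finset.sum_le_sum fun k hk => ?_
    rw [Finset.mem_Ico] at hk
    have hk0 : (0 : ℝ) < k := hN₀.trans_le (hNN k hk.1)
    have hLk := hpos k (hNN k hk.1)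
    rw [hpw _ _ (by exact_mod_cast hn0) hLn]
    have h1 := hN₁ k ((le_max_right _ _).trans hk.1)
    rw [div_lt_iff₀ (by positivity)] at h1
    have h2 := (hb k n (hNN k hk.1) (by exact_mod_cast hk.2.le)).1
    refine le_trans h1.le ?_
    have hq : (0 : ℝ) < (k : ℝ) / n := by positivity
    have h3 : (n : ℝ) ^ β * ((k : ℝ) / n) ^ β = (k : ℝ) ^ β := by
      rw [Real.div_rpow hk0.le hn0.le]; field_simp
    rw [sub_eq_add_neg β ε, Real.rpow_add hq, ← h3]
    calc (A + ε) * ((n : ℝ) ^ β * ((k : ℝ) / n) ^ β * L k)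
        ≤ (A + ε) * ((n : ℝ) ^ β * ((k : ℝ) / n) ^ β *
          (Real.exp ε * ((k : ℝ) / n) ^ (-ε) * L n)) := by gcongr
      _ = _ := by ring

/-! ### Gaussian moments -/

section Gaussian

variable {Ω : Type*} [MeasurableSpace Ω] {P : Measure Ω}

lemma integral_cexp_mul_of_hasGaussianLaw {W : Ω → ℝ} (hW : HasGaussianLaw W P)
    (h0 : ∫ w, W w ∂P = 0) (s : ℝ) :
    ∫ w, Complex.exp (Complex.I * s * W w) ∂P = (Real.exp (-(s ^ 2 * Var[W; P]) / 2) : ℂ) := by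
  have := complexMGF_gaussianReal hW.map_eq_gaussianReal (Complex.I * s)
  rw [complexMGF, h0] at this
  rw [this, Real.coe_toNNReal _ (variance_nonneg _ _)]
  push_cast
  congr 1
  rw [mul_pow, Complex.I_sq]
  ring

lemma integral_mul_cexp_of_hasGaussianLaw {W : Ω → ℝ} (hW : HasGaussianLaw W P)
    (h0 : ∫ w, W w ∂P = 0) (h1 : Var[W; P] = 1) (s : ℝ) :
    ∫ w, (W w : ℂ) * Complex.exp (Complex.I * s * W w) ∂P =
      Complex.I * s * (Real.exp (-s ^ 2 / 2) : ℂ) := by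
  have hmap : P.map W = gaussianReal 0 1 := by
    simpa [h0, h1] using hW.map_eq_gaussianReal
  set z : ℂ := Complex.I * s
  have hd := hasDerivAt_complexMGF (X := (id : ℝ → ℝ)) (μ := gaussianReal 0 1) (z := z) (by simp)
  have hd' : HasDerivAt (complexMGF (id : ℝ → ℝ) (gaussianReal 0 1))
      (z * Complex.exp (z ^ 2 / 2)) z := by
    have hfun : complexMGF (id : ℝ → ℝ) (gaussianReal 0 1) = fun z => Complex.exp (z ^ 2 / 2) := by
      funext z
      rw [complexMGF_gaussianReal (μ := 0) (v := 1) (by simp)]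
      simp
    rw [hfun]
    have h2 : HasDerivAt (fun z : ℂ => z ^ 2 / 2) z z := by
      convert! ((hasDerivAt_id z).pow 2).div_const 2 using 1
      simp
    simpa [mul_comm] using h2.cexp
  have h3 := hd.unique hd'
  rw [← hmap, integral_map hW.aemeasurable (by fun_prop)] at h3
  simp only [id_eq] at h3
  rw [h3]
  congr 1
  push_cast
  congr 1
  simp only [z, mul_pow, Complex.I_sq]
  ring

variable [IsProbabilityMeasure P]

lemma integrable_cexp_mul {W : Ω → ℝ} (hW : AEMeasurable W P) (s : ℝ) :
    Integrable (fun w => Complex.exp (Complex.I * s * W w)) P := by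
  refine Integrable.of_bound (C := 1) (by fun_prop) (ae_of_all _ fun w => ?_)
  rw [Complex.norm_exp]
  simp

/-- Bivariate Gaussian integration by parts for the exponential: `V - ρ U` is independent of
`U`, so `V` may be replaced by `ρ U`. -/
lemma integral_mul_cexp_of_hasGaussianLaw_prodMk {U V : Ω → ℝ}
    (hUV : HasGaussianLaw (fun w => (U w, V w)) P)
    (hU : ∫ w, U w ∂P = 0) (hV : ∫ w, V w ∂P = 0) (hU1 : Var[U; P] = 1) (s : ℝ) :
    ∫ w, (V w : ℂ) * Complex.exp (Complex.I * s * U w) ∂P =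
      cov[U, V; P] * (Complex.I * s * (Real.exp (-s ^ 2 / 2) : ℂ)) := by
  set ρ := cov[U, V; P]
  have hUm := hUV.fst.memLp_two
  have hVm := hUV.snd.memLp_two
  have hUi := hUV.fst.integrable
  have hVi := hUV.snd.integrable
  have hpair : HasGaussianLaw (fun w => (U w, V w - ρ * U w)) P :=
    hUV.map_fun ((ContinuousLinearMap.fst ℝ ℝ ℝ).prod
      (ContinuousLinearMap.snd ℝ ℝ ℝ - ρ • ContinuousLinearMap.fst ℝ ℝ ℝ))
  have hind : IndepFun U (fun w => V w - ρ * U w) P := by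
    refine hpair.indepFun_of_covariance_eq_zero ?_
    rw [covariance_fun_sub_right hUm hVm (hUm.const_mul ρ), covariance_const_mul_right,
      covariance_self hUm.aemeasurable, hU1]
    simp [ρ]
  have hcomp : IndepFun (fun w => Complex.exp (Complex.I * s * U w))
      (fun w => ((V w - ρ * U w : ℝ) : ℂ)) P :=
    hind.comp (φ := fun x : ℝ => Complex.exp (Complex.I * s * x)) (ψ := fun x : ℝ => (x : ℂ))
      (by fun_prop) (by fun_prop)
  have hUa := hUm.aemeasurable
  have hVa := hVm.aemeasurable
  have hprod := hcomp.integral_fun_mul_eq_mul_integral (by fun_prop) (by fun_prop)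
  have hzero : ∫ w, ((V w - ρ * U w : ℝ) : ℂ) ∂P = 0 := by
    rw [integral_complex_ofReal, integral_sub hVi (hUi.const_mul ρ), integral_const_mul, hU, hV]
    simp
  have hbd : ∀ {W : Ω → ℝ}, Integrable W P →
      Integrable (fun w => (W w : ℂ) * Complex.exp (Complex.I * s * U w)) P := fun hW =>
    hW.ofReal.mul_bdd (c := 1) (by fun_prop) (ae_of_all _ fun w => by
      rw [Complex.norm_exp]; simp)
  rw [hzero, mul_zero] at hprod
  rw [← integral_mul_cexp_of_hasGaussianLaw hUV.fst hU hU1 s, ← integral_const_mul,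
    ← sub_eq_zero, ← integral_sub (hbd hVi) ((hbd hUi).const_mul _), ← hprod]
  refine integral_congr_ae (ae_of_all _ fun w => ?_)
  push_cast
  ring

/-- What is left of `exp (i s x)` after its expansion in Hermite polynomials has been cut off
after degree one. -/
noncomputable def hermiteRemainder (s x : ℝ) : ℂ :=
  Complex.exp (Complex.I * s * x) - (Real.exp (-s ^ 2 / 2) : ℂ) - J₁ s * x

/-- The covariance of `hermiteRemainder s U` and `hermiteRemainder s V` for standard Gaussian
`U`, `V` with correlation `ρ`. -/
noncomputable def remainderCov (s ρ : ℝ) : ℝ :=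
  Real.exp (-s ^ 2) * (Real.exp (s ^ 2 * ρ) - 1 - s ^ 2 * ρ)

/-- Expanding the product leaves exponentials, monomials and mixed terms `V exp (i s U)`, all with
explicit Gaussian integrals; the terms of order at most one in `ρ` cancel. -/
lemma integral_hermiteRemainder_mul_conj {U V : Ω → ℝ}
    (hUV : HasGaussianLaw (fun w => (U w, V w)) P)
    (hU : ∫ w, U w ∂P = 0) (hV : ∫ w, V w ∂P = 0) (hU1 : Var[U; P] = 1) (hV1 : Var[V; P] = 1)
    (s : ℝ) :
    Integrable (fun w => hermiteRemainder s (U w) * (starRingEnd ℂ) (hermiteRemainder s (V w))) P ∧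
    ∫ w, hermiteRemainder s (U w) * (starRingEnd ℂ) (hermiteRemainder s (V w)) ∂P =
      (remainderCov s cov[U, V; P] : ℂ) := by
  have hVU : HasGaussianLaw (fun w => (V w, U w)) P :=
    hUV.map_fun ((ContinuousLinearMap.snd ℝ ℝ ℝ).prod (ContinuousLinearMap.fst ℝ ℝ ℝ))
  have hUm := hUV.fst.memLp_two
  have hVm := hUV.snd.memLp_two
  have hUi := hUV.fst.integrable
  have hVi := hUV.snd.integrable
  have hUa := hUm.aemeasurable
  have hVa := hVm.aemeasurable
  set ρ := cov[U, V; P] with hρ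
  have hρ' : cov[V, U; P] = ρ := covariance_comm _ _
  have hbd : ∀ {W W' : Ω → ℝ} (t : ℝ), Integrable W P → AEMeasurable W' P →
      Integrable (fun w => (W w : ℂ) * Complex.exp (Complex.I * t * W' w)) P := fun t hW hW' =>
    hW.ofReal.mul_bdd (c := 1) (by fun_prop) (ae_of_all _ fun w => by
      rw [Complex.norm_exp]; simp)
  -- the integrals of the individual products
  let HI : (Ω → ℂ) → ℂ → Prop := fun f a => Integrable f P ∧ ∫ w, f w ∂P = a
  have hadd : ∀ {f g : Ω → ℂ} {a b : ℂ}, HI f a → HI g b → HI (fun w => f w + g w) (a + b) :=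
    fun hf hg => ⟨hf.1.add hg.1, by rw [integral_add hf.1 hg.1, hf.2, hg.2]⟩
  have hmul : ∀ {f : Ω → ℂ} {a : ℂ} (k : ℂ), HI f a → HI (fun w => k * f w) (k * a) :=
    fun k hf => ⟨hf.1.const_mul k, by rw [integral_const_mul, hf.2]⟩
  have t1 : HI (fun w => Complex.exp (Complex.I * s * ((U w - V w : ℝ) : ℂ)))
      (Real.exp (-(s ^ 2 * (2 - 2 * ρ)) / 2)) := by
    refine ⟨integrable_cexp_mul (by fun_prop) s, ?_⟩
    rw [integral_cexp_mul_of_hasGaussianLaw (W := fun w => U w - V w) hUV.fun_sub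
      (by rw [integral_sub hUi hVi, hU, hV, sub_zero]), variance_fun_sub hUm hVm, hU1, hV1]
    congr 4
    ring
  have t2 : HI (fun w => Complex.exp (Complex.I * s * U w)) (Real.exp (-s ^ 2 / 2)) := by
    refine ⟨integrable_cexp_mul hUa s, ?_⟩
    rw [integral_cexp_mul_of_hasGaussianLaw hUV.fst hU, hU1, mul_one]
  have t3 : HI (fun w => Complex.exp (Complex.I * (-s : ℝ) * V w)) (Real.exp (-s ^ 2 / 2)) := by
    refine ⟨integrable_cexp_mul hVa (-s), ?_⟩
    rw [integral_cexp_mul_of_hasGaussianLaw hUV.snd hV, hV1, mul_one, neg_sq]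
  have t4 : HI (fun w => (V w : ℂ) * Complex.exp (Complex.I * s * U w))
      (ρ * (Complex.I * s * (Real.exp (-s ^ 2 / 2) : ℂ))) :=
    ⟨hbd s hVi hUa, integral_mul_cexp_of_hasGaussianLaw_prodMk hUV hU hV hU1 s⟩
  have t5 : HI (fun w => (U w : ℂ) * Complex.exp (Complex.I * (-s : ℝ) * V w))
      (ρ * (Complex.I * (-s : ℝ) * (Real.exp (-s ^ 2 / 2) : ℂ))) := by
    refine ⟨hbd (-s) hUi hVa, ?_⟩
    rw [integral_mul_cexp_of_hasGaussianLaw_prodMk hVU hV hU hV1 (-s), hρ', neg_sq]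
  have t6 : HI (fun w => (U w : ℂ)) 0 :=
    ⟨hUi.ofReal, by rw [integral_complex_ofReal, hU, Complex.ofReal_zero]⟩
  have t7 : HI (fun w => (V w : ℂ)) 0 :=
    ⟨hVi.ofReal, by rw [integral_complex_ofReal, hV, Complex.ofReal_zero]⟩
  have t8 : HI (fun w => ((U w * V w : ℝ) : ℂ)) ρ := by
    refine ⟨(hUm.integrable_mul hVm).ofReal, ?_⟩
    rw [integral_complex_ofReal, hρ, covariance_eq_sub hUm hVm, hU]
    simp
  have t9 : HI (fun _ => (1 : ℂ)) 1 := ⟨integrable_const _, by simp⟩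
  set e : ℂ := (Real.exp (-s ^ 2 / 2) : ℂ) with he
  have key := hadd (hadd (hadd (hadd (hadd (hadd (hadd (hadd t1 (hmul (-e) t2)) (hmul (-e) t3))
    (hmul (Complex.I * e * s) t4)) (hmul (-(Complex.I * e * s)) t5))
    (hmul (Complex.I * e ^ 2 * s) t6)) (hmul (-(Complex.I * e ^ 2 * s)) t7))
    (hmul (e ^ 2 * s ^ 2) t8)) (hmul (e ^ 2) t9)
  have hce : (starRingEnd ℂ) e = e := Complex.conj_ofReal _
  have hfun : ∀ w, hermiteRemainder s (U w) * (starRingEnd ℂ) (hermiteRemainder s (V w)) =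
      Complex.exp (Complex.I * s * ((U w - V w : ℝ) : ℂ)) +
      -e * Complex.exp (Complex.I * s * U w) + -e * Complex.exp (Complex.I * (-s : ℝ) * V w) +
      Complex.I * e * s * ((V w : ℂ) * Complex.exp (Complex.I * s * U w)) +
      -(Complex.I * e * s) * ((U w : ℂ) * Complex.exp (Complex.I * (-s : ℝ) * V w)) +
      Complex.I * e ^ 2 * s * U w + -(Complex.I * e ^ 2 * s) * V w +
      e ^ 2 * s ^ 2 * ((U w * V w : ℝ) : ℂ) + e ^ 2 * 1 := by
    intro w
    have h1 : Complex.exp (Complex.I * s * ((U w - V w : ℝ) : ℂ)) =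
        Complex.exp (Complex.I * s * U w) * Complex.exp (Complex.I * (-s : ℝ) * V w) := by
      rw [← Complex.exp_add]; congr 1; push_cast; ring
    rw [h1]
    simp only [hermiteRemainder, J₁, map_sub, map_mul, ← Complex.exp_conj, Complex.conj_I,
      Complex.conj_ofReal, ← he, hce]
    have h2 : -Complex.I * (s : ℂ) * (V w : ℂ) = Complex.I * (-s : ℝ) * V w := by push_cast; ring
    rw [h2]
    push_cast
    linear_combination (-(e ^ 2 * s ^ 2 * U w * V w)) * Complex.I_sq
  simp_rw [hfun]
  refine ⟨key.1, key.2.trans ?_⟩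
  have he2 : e ^ 2 = (Real.exp (-s ^ 2) : ℂ) := by
    rw [he, ← Complex.ofReal_pow, ← Real.exp_nat_mul]
    congr 2
    push_cast
    ring
  have h1 : (Real.exp (-(s ^ 2 * (2 - 2 * ρ)) / 2) : ℂ) = e ^ 2 * Real.exp (s ^ 2 * ρ) := by
    rw [he2, ← Complex.ofReal_mul, ← Real.exp_add]
    congr 2
    ring
  rw [h1, remainderCov]
  simp only [Complex.ofReal_mul, Complex.ofReal_sub, Complex.ofReal_one, Complex.ofReal_pow,
    Complex.ofReal_neg, ← he2]
  linear_combination (2 * e ^ 2 * s ^ 2 * ρ) * Complex.I_sq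

end Gaussian

/-- Termwise comparison of the exponential series from degree two on. -/
lemma exp_mul_sub_le {u ρ : ℝ} (hu : 0 ≤ u) (hρ : |ρ| ≤ 1) :
    Real.exp (u * ρ) - 1 - u * ρ ≤ ρ ^ 2 * (Real.exp u - 1 - u) := by
  have hs : ∀ x : ℝ, HasSum (fun n : ℕ => x ^ (n + 2) / ((n + 2).factorial : ℝ))
      (Real.exp x - 1 - x) := by
    intro x
    have h := NormedSpace.expSeries_div_hasSum_exp (𝔸 := ℝ) x
    rw [← Real.exp_eq_exp_ℝ] at h
    have := (hasSum_nat_add_iff' 2).2 h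
    simpa [Finset.sum_range_succ, sub_sub] using this
  refine hasSum_le (fun n => ?_) (hs (u * ρ)) ((hs u).mul_left (ρ ^ 2))
  have h1 : ρ ^ n ≤ 1 :=
    (le_abs_self _).trans (by rw [abs_pow]; exact pow_le_one₀ (abs_nonneg _) hρ)
  have h2 : (u * ρ) ^ (n + 2) ≤ ρ ^ 2 * u ^ (n + 2) := by
    rw [mul_pow, pow_add ρ]
    have : 0 ≤ ρ ^ 2 * u ^ (n + 2) := by positivity
    nlinarith
  rw [← mul_div_assoc]
  gcongr

lemma remainderCov_le {s ρ : ℝ} (hρ : |ρ| ≤ 1) :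
    remainderCov s ρ ≤ ρ ^ 2 * min 1 (s ^ 2) := by
  have h1 := exp_mul_sub_le (sq_nonneg s) hρ
  have h2 : remainderCov s ρ ≤ Real.exp (-s ^ 2) * (ρ ^ 2 * (Real.exp (s ^ 2) - 1 - s ^ 2)) :=
    mul_le_mul_of_nonneg_left h1 (Real.exp_pos _).le
  have h3 : Real.exp (-s ^ 2) * Real.exp (s ^ 2) = 1 := by rw [← Real.exp_add]; simp
  have h4 : 1 - s ^ 2 ≤ Real.exp (-s ^ 2) := by linarith [Real.add_one_le_exp (-s ^ 2)]
  have h5 := Real.exp_pos (-s ^ 2)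
  have h6 : 0 ≤ Real.exp (-s ^ 2) * s ^ 2 := by positivity
  calc remainderCov s ρ ≤ _ := h2
    _ = ρ ^ 2 * (1 - Real.exp (-s ^ 2) - Real.exp (-s ^ 2) * s ^ 2) := by
      linear_combination ρ ^ 2 * h3
    _ ≤ ρ ^ 2 * min 1 (s ^ 2) := by
      refine mul_le_mul_of_nonneg_left (le_min ?_ ?_) (sq_nonneg _) <;> linarith

/-! ### Second-order structure of long-range dependent sequences -/

/-- Summing the symmetric Toeplitz matrix with entries `f |i - j|` by adding one row and one column
at a time. -/
lemma sum_sum_natDist (f : ℕ → ℝ) (n : ℕ) :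
    ∑ i ∈ Finset.range n, ∑ j ∈ Finset.range n, f (Nat.dist i j) =
      ∑ m ∈ Finset.range n, (2 * ∑ k ∈ Finset.range (m + 1), f k - f 0) := by
  induction n with
  | zero => simp
  | succ n ih =>
    have h1 : ∑ i ∈ Finset.range n, f (Nat.dist i n) = ∑ k ∈ Finset.range n, f (k + 1) := by
      rw [← Finset.sum_range_reflect]
      refine Finset.sum_congr rfl fun i hi => ?_
      rw [Finset.mem_range] at hi
      rw [Nat.dist_eq_sub_of_le (by omega)]
      congr 1
      omega
    have h2 : ∑ j ∈ Finset.range n, f (Nat.dist n j) = ∑ k ∈ Finset.range n, f (k + 1) := by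
      simp_rw [Nat.dist_comm n]; exact h1
    rw [Finset.sum_range_succ (fun m => 2 * ∑ k ∈ Finset.range (m + 1), f k - f 0) n, ← ih]
    simp_rw [Finset.sum_range_succ _ n]
    rw [Finset.sum_add_distrib, h1, h2, Nat.dist_self]
    have h3 := Finset.sum_range_succ' f n
    rw [Finset.sum_range_succ] at h3
    linarith

lemma SlowlyVarying.tendsto_rpow_neg_mul {L : ℝ → ℝ} (hL : SlowlyVarying L) {β : ℝ}
    (hβ : 0 < β) : Tendsto (fun n : ℕ => (n : ℝ) ^ (-β) * L n) atTop (𝓝 0) := by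
  obtain ⟨N, hN, hpos, hb⟩ := hL.exists_ratio_bounds (half_pos hβ)
  set C : ℝ := L N * Real.exp (β / 2) * N ^ (-(β / 2)) with hC
  have h1 : Tendsto (fun n : ℕ => C * (n : ℝ) ^ (-(β / 2))) atTop (𝓝 0) := by
    simpa using ((tendsto_rpow_neg_atTop (half_pos hβ)).comp
      tendsto_natCast_atTop_atTop).const_mul C
  refine tendsto_of_tendsto_of_tendsto_of_le_of_le' tendsto_const_nhds h1 ?_ ?_
  · filter_upwards [tendsto_natCast_atTop_atTop.eventually (eventually_ge_atTop N)] with n hn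
    have := hpos n hn
    positivity
  · filter_upwards [tendsto_natCast_atTop_atTop.eventually (eventually_ge_atTop N)] with n hn
    have hn0 : (0 : ℝ) < n := hN.trans_le hn
    have h2 := (hb N n le_rfl hn).2
    have h3 : (n : ℝ) ^ (-β) = (n : ℝ) ^ (-(β / 2)) * (n : ℝ) ^ (-(β / 2)) := by
      rw [← Real.rpow_add hn0]; congr 1; ring
    have h4 : Real.exp (-(β / 2)) * Real.exp (β / 2) = 1 := by rw [← Real.exp_add]; simp
    have h5 : (N / n : ℝ) ^ (β / 2) * N ^ (-(β / 2)) = (n : ℝ) ^ (-(β / 2)) := by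
      rw [Real.div_rpow hN.le hn0.le, Real.rpow_neg hN.le, Real.rpow_neg hn0.le]
      have := (Real.rpow_pos_of_pos hN (β / 2)).ne'
      field_simp
    calc (n : ℝ) ^ (-β) * L n
        = (Real.exp (-(β / 2)) * (N / n : ℝ) ^ (β / 2) * L n) *
          Real.exp (β / 2) * N ^ (-(β / 2)) * (n : ℝ) ^ (-(β / 2)) := by
          rw [h3, ← h5]
          linear_combination (-((N / n : ℝ) ^ (β / 2) * N ^ (-(β / 2))) ^ 2 * L n) * h4
      _ ≤ L N * Real.exp (β / 2) * N ^ (-(β / 2)) * (n : ℝ) ^ (-(β / 2)) := by gcongr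

section LRD

variable {D : ℝ} {L : ℝ → ℝ} {r : ℕ → ℝ}

lemma eventually_autocov_eq (hL : SlowlyVarying L)
    (hr : ∀ k : ℕ, 1 ≤ k → r k = (k : ℝ) ^ (-D) * L k) :
    ∀ᶠ n : ℕ in atTop, 0 < L n ∧ (0 : ℝ) < n ∧ r n = (n : ℝ) ^ (-D) * L n := by
  filter_upwards [tendsto_natCast_atTop_atTop.eventually hL.eventually_pos,
    eventually_ge_atTop 1] with n h1 h2
  exact ⟨h1, by exact_mod_cast h2, hr n h2⟩

/-- Karamata's theorem applied twice: the double sum of a regularly varying autocovariance. -/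
lemma tendsto_sum_sum_autocov (hD : D < 1) (hL : SlowlyVarying L)
    (hr : ∀ k : ℕ, 1 ≤ k → r k = (k : ℝ) ^ (-D) * L k) :
    Tendsto (fun n : ℕ => (∑ i ∈ Finset.range n, ∑ j ∈ Finset.range n, r (Nat.dist i j)) /
      ((n : ℝ) ^ (2 - D) * L n)) atTop (𝓝 (limitVar D)) := by
  have hD1 : 0 < 1 - D := by linarith
  have hev := eventually_autocov_eq hL hr
  have hS : Tendsto (fun n : ℕ => (∑ k ∈ Finset.range n, r k) / ((n : ℝ) ^ (1 - D) * L n)) atTop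
      (𝓝 (1 / (1 - D))) := by
    have := hL.tendsto_sum_div (β := -D) (A := 1) (a := r) (by linarith) one_pos ?_
    · simpa [neg_add_eq_sub] using this
    · refine tendsto_const_nhds.congr' ?_
      filter_upwards [hev] with n hn
      have := hn.1
      have := hn.2.1
      rw [hn.2.2, div_self (by positivity)]
  have hr0 : Tendsto (fun n : ℕ => r n / ((n : ℝ) ^ (1 - D) * L n)) atTop (𝓝 0) := by
    refine (tendsto_inv_atTop_nhds_zero_nat (𝕜 := ℝ)).congr' ?_
    filter_upwards [hev] with n hn
    have h1 := hn.1
    have h2 := hn.2.1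
    rw [hn.2.2, sub_eq_add_neg, Real.rpow_add h2, Real.rpow_one]
    have := (Real.rpow_pos_of_pos h2 (-D)).ne'
    field_simp
  have hc : Tendsto (fun n : ℕ => r 0 / ((n : ℝ) ^ (1 - D) * L n)) atTop (𝓝 0) :=
    (hL.tendsto_rpow_mul_atTop hD1).const_div_atTop _
  have ha : Tendsto (fun n : ℕ => (2 * ∑ k ∈ Finset.range (n + 1), r k - r 0) /
      ((n : ℝ) ^ (1 - D) * L n)) atTop (𝓝 (2 / (1 - D))) := by
    have := ((hS.const_mul 2).add (hr0.const_mul 2)).sub hc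
    rw [show 2 * (1 / (1 - D)) + 2 * 0 - 0 = 2 / (1 - D) by ring] at this
    refine this.congr fun n => ?_
    rw [Finset.sum_range_succ]
    ring
  have := hL.tendsto_sum_div (β := 1 - D) (by linarith) (by positivity) ha
  simp_rw [sum_sum_natDist]
  convert! this using 2
  · congr 3; ring
  · rw [limitVar, div_div]; congr 2; ring

/-- Since `r → 0` and `∑ |r|` diverges, the squares `r²` sum to a smaller order than `|r|`. -/
lemma tendsto_sum_sum_autocov_sq (hD0 : 0 < D) (hD : D < 1) (hL : SlowlyVarying L)
    (hr : ∀ k : ℕ, 1 ≤ k → r k = (k : ℝ) ^ (-D) * L k) :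
    Tendsto (fun n : ℕ => (∑ i ∈ Finset.range n, ∑ j ∈ Finset.range n, r (Nat.dist i j) ^ 2) /
      ((n : ℝ) ^ (2 - D) * L n)) atTop (𝓝 0) := by
  have hD1 : 0 < 1 - D := by linarith
  have hev := eventually_autocov_eq hL hr
  have hSabs : Tendsto (fun n : ℕ => (∑ k ∈ Finset.range n, |r k|) / ((n : ℝ) ^ (1 - D) * L n))
      atTop (𝓝 (1 / (1 - D))) := by
    have := hL.tendsto_sum_div (β := -D) (A := 1) (a := fun n => |r n|) (by linarith) one_pos ?_
    · simpa [neg_add_eq_sub] using this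
    · refine tendsto_const_nhds.congr' ?_
      filter_upwards [hev] with n hn
      have := hn.1
      have := hn.2.1
      rw [hn.2.2, abs_of_pos (by positivity), div_self (by positivity)]
  have hden := hL.tendsto_rpow_mul_atTop hD1
  have hdiv : Tendsto (fun n => ∑ k ∈ Finset.range n, |r k|) atTop atTop := by
    refine (Tendsto.pos_mul_atTop (by positivity) hSabs hden).congr' ?_
    filter_upwards [hden.eventually_gt_atTop 0] with n hn
    exact div_mul_cancel₀ _ hn.ne'
  have hr0 : Tendsto r atTop (𝓝 0) := by
    refine (hL.tendsto_rpow_neg_mul hD0).congr' ?_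
    filter_upwards [hev] with n hn
    exact hn.2.2.symm
  have hlo : (fun k => r k ^ 2) =o[atTop] fun k => |r k| := by
    have h1 : (fun k => r k * r k) =o[atTop] fun k => (1 : ℝ) * r k :=
      ((Asymptotics.isLittleO_one_iff ℝ).2 hr0).mul_isBigO (Asymptotics.isBigO_refl _ _)
    simp only [one_mul, ← sq] at h1
    exact h1.abs_right
  have hQ : Tendsto (fun n : ℕ => (∑ k ∈ Finset.range n, r k ^ 2) / ((n : ℝ) ^ (1 - D) * L n))
      atTop (𝓝 0) := by
    have h2 := (hlo.sum_range (fun k => abs_nonneg (r k)) hdiv).tendsto_div_nhds_zero.mul hSabs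
    rw [zero_mul] at h2
    refine h2.congr' ?_
    filter_upwards [hdiv.eventually_gt_atTop 0] with n hn
    field_simp
  refine tendsto_of_tendsto_of_tendsto_of_le_of_le' tendsto_const_nhds
    (by simpa using hQ.const_mul 2) ?_ ?_
  · filter_upwards [hev] with n hn
    have := hn.1
    positivity
  · filter_upwards [hev] with n hn
    have h1 := hn.1
    have h2 := hn.2.1
    rw [sum_sum_natDist (fun k => r k ^ 2), show 2 - D = (1 - D) + 1 by ring,
      Real.rpow_add_one h2.ne', ← mul_div_assoc, div_le_div_iff₀ (by positivity) (by positivity)]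
    have h3 : ∑ m ∈ Finset.range n, (2 * ∑ k ∈ Finset.range (m + 1), r k ^ 2 - r 0 ^ 2) ≤
        n * (2 * ∑ k ∈ Finset.range n, r k ^ 2) := by
      rw [← nsmul_eq_mul]
      refine (Finset.sum_le_card_nsmul _ _ _ fun m hm => ?_).trans_eq (by rw [Finset.card_range])
      rw [Finset.mem_range] at hm
      have h4 : ∑ k ∈ Finset.range (m + 1), r k ^ 2 ≤ ∑ k ∈ Finset.range n, r k ^ 2 :=
        Finset.sum_le_sum_of_subset_of_nonneg (Finset.range_mono hm) fun _ _ _ => sq_nonneg _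
      nlinarith [sq_nonneg (r 0)]
    calc _ ≤ (n * (2 * ∑ k ∈ Finset.range n, r k ^ 2)) * ((n : ℝ) ^ (1 - D) * L n) := by gcongr
      _ = _ := by ring

end LRD

section TimeSeries

variable {Ω : Type*} [MeasurableSpace Ω] {P : Measure Ω} {X : ℕ → Ω → ℝ} {D : ℝ} {L : ℝ → ℝ}

lemma IsStandardLRDGaussian.integral_eq_zero (hX : IsStandardLRDGaussian P X D L) (i : ℕ) :
    ∫ w, X i w ∂P = 0 := (hX.stationary.mean_eq i).trans hX.mean_zero

lemma IsStandardLRDGaussian.cov_eq_natDist (hX : IsStandardLRDGaussian P X D L) (i j : ℕ) :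
    cov[X i, X j; P] = cov[X 0, X (Nat.dist i j); P] := by
  rcases le_total i j with h | h
  · obtain ⟨k, rfl⟩ := Nat.exists_eq_add_of_le h
    rw [hX.stationary.cov_eq, Nat.dist_eq_sub_of_le h, Nat.add_sub_cancel_left]
  · obtain ⟨k, rfl⟩ := Nat.exists_eq_add_of_le h
    rw [covariance_comm, hX.stationary.cov_eq, Nat.dist_comm, Nat.dist_eq_sub_of_le h,
      Nat.add_sub_cancel_left]

lemma IsStandardLRDGaussian.aemeasurable (hX : IsStandardLRDGaussian P X D L) (i : ℕ) :
    AEMeasurable (X i) P := (hX.stationary.memLp_two i).aemeasurable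

lemma IsStandardLRDGaussian.variance_eq_one (hX : IsStandardLRDGaussian P X D L) (i : ℕ) :
    Var[X i; P] = 1 := by
  rw [← covariance_self (hX.aemeasurable i), hX.cov_eq_natDist, Nat.dist_self,
    covariance_self (hX.aemeasurable 0), hX.variance_one]

lemma IsStandardLRDGaussian.marginalCharFun_eq (hX : IsStandardLRDGaussian P X D L) (s : ℝ) :
    marginalCharFun P X s = (Real.exp (-s ^ 2 / 2) : ℂ) := by
  rw [marginalCharFun, (hX.gaussian.hasGaussianLaw_eval 0).map_eq_gaussianReal, hX.mean_zero,
    hX.variance_one, charFun_gaussianReal]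
  push_cast
  simp
  ring_nf

lemma IsStandardLRDGaussian.hasGaussianLaw_sampleMean (hX : IsStandardLRDGaussian P X D L)
    (n : ℕ) : HasGaussianLaw (sampleMean X n) P := by
  have := (hX.gaussian.hasGaussianLaw_fun_sum (I := Finset.range n)).fun_smul ((n : ℝ)⁻¹)
  refine this.congr (ae_of_all _ fun w => ?_)
  simp only [sampleMean, smul_eq_mul]
  ring

variable [IsProbabilityMeasure P]

lemma IsStandardLRDGaussian.abs_cov_le_one (hX : IsStandardLRDGaussian P X D L) (i j : ℕ) :
    |cov[X i, X j; P]| ≤ 1 := by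
  have h1 := variance_add (hX.stationary.memLp_two i) (hX.stationary.memLp_two j)
  have h2 := variance_sub (hX.stationary.memLp_two i) (hX.stationary.memLp_two j)
  rw [hX.variance_eq_one, hX.variance_eq_one] at h1 h2
  have h3 := variance_nonneg (X i + X j) P
  have h4 := variance_nonneg (X i - X j) P
  rw [abs_le]
  constructor <;> linarith

lemma IsStandardLRDGaussian.integral_sampleMean (hX : IsStandardLRDGaussian P X D L) (n : ℕ) :
    ∫ w, sampleMean X n w ∂P = 0 := by
  simp only [sampleMean]
  rw [integral_div, integral_finsetSum _ fun i _ => (hX.stationary.memLp_two i).integrable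
    one_le_two]
  simp [hX.integral_eq_zero]

lemma IsStandardLRDGaussian.variance_sampleMean (hX : IsStandardLRDGaussian P X D L) (n : ℕ) :
    Var[sampleMean X n; P] = (∑ i ∈ Finset.range n, ∑ j ∈ Finset.range n,
      cov[X 0, X (Nat.dist i j); P]) / (n : ℝ) ^ 2 := by
  simp_rw [← hX.cov_eq_natDist]
  rw [← variance_fun_sum' fun i _ => hX.stationary.memLp_two i]
  have : sampleMean X n = fun w => (n : ℝ)⁻¹ * ∑ i ∈ Finset.range n, X i w := by
    funext w; simp only [sampleMean]; ring
  rw [this, variance_const_mul]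
  ring

lemma rpow_two_sub_mul_eq {n : ℝ} (hn : 0 < n) (a : ℝ) :
    n ^ (2 - D) * a = n ^ 2 * (n ^ (-D) * a) := by
  rw [sub_eq_add_neg, Real.rpow_add hn, Real.rpow_two]; ring

lemma IsStandardLRDGaussian.tendsto_variance_sampleMean (hX : IsStandardLRDGaussian P X D L) :
    Tendsto (fun n : ℕ => Var[sampleMean X n; P] / ((n : ℝ) ^ (-D) * L n)) atTop
      (𝓝 (limitVar D)) := by
  refine (tendsto_sum_sum_autocov hX.param_lt_one hX.slowlyVarying hX.cov_lag).congr' ?_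
  filter_upwards [eventually_gt_atTop 0] with n hn
  rw [hX.variance_sampleMean, rpow_two_sub_mul_eq (by exact_mod_cast hn), div_div]

end TimeSeries

/-! ### The weighted L² spaces -/

/-- The one-dimensional weight `(c s²)⁻¹ ds`, of which `weightMeasure c` is the square. -/
noncomputable def lineWeight (c : ℝ) : Measure ℝ :=
  volume.withDensity fun s => ENNReal.ofReal ((c * s ^ 2)⁻¹)

instance (c : ℝ) : SFinite (lineWeight c) := by unfold lineWeight; infer_instance

lemma weightMeasure_eq_prod {c : ℝ} (hc : 0 < c) :
    weightMeasure c = (lineWeight c).prod (lineWeight c) := by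
  rw [lineWeight, prod_withDensity (by fun_prop) (by fun_prop), weightMeasure,
    Measure.volume_eq_prod]
  congr 1
  funext p
  rw [← ENNReal.ofReal_mul (by positivity), ← mul_inv]
  congr 2
  ring

lemma sFinite_weightMeasure (c : ℝ) : SFinite (weightMeasure c) := by
  unfold weightMeasure; infer_instance

lemma lintegral_min_lineWeight_ne_top {c : ℝ} (hc : 0 < c) :
    ∫⁻ s, ENNReal.ofReal (min 1 (s ^ 2)) ∂(lineWeight c) ≠ ⊤ := by
  rw [lineWeight, lintegral_withDensity_eq_lintegral_mul _ (by fun_prop) (by fun_prop)]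
  have hint : Integrable (fun s : ℝ => c⁻¹ * 2 * (1 + s ^ 2)⁻¹) :=
    integrable_inv_one_add_sq.const_mul _
  refine ne_top_of_le_ne_top hint.lintegral_lt_top.ne (lintegral_mono fun s => ?_)
  rw [Pi.mul_apply, ← ENNReal.ofReal_mul (by positivity)]
  refine ENNReal.ofReal_le_ofReal ?_
  rcases eq_or_ne s 0 with rfl | hs
  · simp; positivity
  · have hs2 : 0 < s ^ 2 := by positivity
    have h1 : min 1 (s ^ 2) * (1 + s ^ 2) ≤ 2 * s ^ 2 := by
      rcases le_total 1 (s ^ 2) with h | h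
      · rw [min_eq_left h]; linarith
      · rw [min_eq_right h]; nlinarith
    rw [mul_inv, mul_assoc, mul_assoc]
    refine mul_le_mul_of_nonneg_left ?_ (by positivity)
    rw [inv_mul_le_iff₀ hs2, mul_comm 2, mul_left_comm, ← div_eq_inv_mul,
      le_div_iff₀ (by positivity)]
    linarith

lemma eLpNorm_two_sq {α : Type*} [MeasurableSpace α] (μ : Measure α) (f : α → ℂ) :
    eLpNorm f 2 μ ^ 2 = ∫⁻ x, ‖f x‖ₑ ^ 2 ∂μ := by
  rw [eLpNorm_eq_lintegral_rpow_enorm_toReal (by simp) (by simp), ← ENNReal.rpow_natCast,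
    ← ENNReal.rpow_mul]
  simp

lemma enorm_sq_eq_ofReal (z : ℂ) : ‖z‖ₑ ^ 2 = ENNReal.ofReal (‖z‖ ^ 2) := by
  rw [ENNReal.ofReal_pow (norm_nonneg _), ofReal_norm]

/-- The weight is integrable against `min 1 s²`, so a function bounded at infinity and of order `s`
at the origin is square-integrable. -/
lemma memLp_lineWeight_of_sq_le {c : ℝ} (hc : 0 < c) {f : ℝ → ℂ} (hf : Measurable f) (C : ℝ)
    (h : ∀ s, ‖f s‖ ^ 2 ≤ C * min 1 (s ^ 2)) : MemLp f 2 (lineWeight c) := by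
  refine ⟨hf.aestronglyMeasurable, ?_⟩
  have h1 : eLpNorm f 2 (lineWeight c) ^ 2 < ⊤ := by
    rw [eLpNorm_two_sq]
    calc ∫⁻ s, ‖f s‖ₑ ^ 2 ∂(lineWeight c)
        ≤ ∫⁻ s, ENNReal.ofReal C * ENNReal.ofReal (min 1 (s ^ 2)) ∂(lineWeight c) := by
          refine lintegral_mono fun s => ?_
          rw [enorm_sq_eq_ofReal, ← ENNReal.ofReal_mul' (by positivity)]
          exact ENNReal.ofReal_le_ofReal (h s)
      _ = ENNReal.ofReal C * ∫⁻ s, ENNReal.ofReal (min 1 (s ^ 2)) ∂(lineWeight c) :=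
          lintegral_const_mul _ (by fun_prop)
      _ < ⊤ := ENNReal.mul_lt_top ENNReal.ofReal_lt_top (lintegral_min_lineWeight_ne_top hc).lt_top
  by_contra h2
  rw [not_lt, top_le_iff] at h2
  simp [h2] at h1

lemma eLpNorm_tensor {α β : Type*} [MeasurableSpace α] [MeasurableSpace β] {μ : Measure α}
    {ν : Measure β} [SFinite μ] [SFinite ν] {f : α → ℂ} {g : β → ℂ}
    (hf : AEStronglyMeasurable f μ) (hg : AEStronglyMeasurable g ν) :
    eLpNorm (fun p : α × β => f p.1 * g p.2) 2 (μ.prod ν) = eLpNorm f 2 μ * eLpNorm g 2 ν := by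
  have h : eLpNorm (fun p : α × β => f p.1 * g p.2) 2 (μ.prod ν) ^ 2 =
      (eLpNorm f 2 μ * eLpNorm g 2 ν) ^ 2 := by
    rw [mul_pow, eLpNorm_two_sq, eLpNorm_two_sq, eLpNorm_two_sq]
    simp_rw [enorm_mul, mul_pow]
    exact lintegral_prod_mul (hf.enorm.pow_const 2) (hg.enorm.pow_const 2)
  exact (ENNReal.pow_right_strictMono two_ne_zero).injective h

lemma measurable_J₁ : Measurable J₁ := by unfold J₁; fun_prop

lemma norm_J₁_sq_le (s : ℝ) : ‖J₁ s‖ ^ 2 ≤ 1 * min 1 (s ^ 2) := by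
  have h1 : ‖J₁ s‖ ^ 2 = Real.exp (-s ^ 2) * s ^ 2 := by
    simp only [J₁, norm_mul, Complex.norm_I, one_mul, Complex.norm_real, mul_pow, Real.norm_eq_abs,
      sq_abs, ← Real.exp_nat_mul]
    congr 2
    push_cast
    ring
  have h2 : s ^ 2 ≤ Real.exp (s ^ 2) := by linarith [Real.add_one_le_exp (s ^ 2)]
  have h3 : Real.exp (-s ^ 2) ≤ 1 := Real.exp_le_one_iff.2 (by nlinarith [sq_nonneg s])
  rw [h1, one_mul]
  refine le_min ?_ ?_
  · rw [Real.exp_neg, inv_mul_le_iff₀ (Real.exp_pos _)]; linarith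
  · nlinarith [sq_nonneg s]

lemma memLp_J₁ {c : ℝ} (hc : 0 < c) : MemLp J₁ 2 (lineWeight c) :=
  memLp_lineWeight_of_sq_le hc measurable_J₁ 1 norm_J₁_sq_le

lemma memLp_cexp_sub {c : ℝ} (hc : 0 < c) (x : ℝ) :
    MemLp (fun s : ℝ => Complex.exp (Complex.I * s * x) - (Real.exp (-s ^ 2 / 2) : ℂ)) 2
      (lineWeight c) := by
  refine memLp_lineWeight_of_sq_le hc (by fun_prop) ((|x| + 2) ^ 2) fun s => ?_
  have e1 : ‖Complex.exp (Complex.I * s * x)‖ = 1 := by rw [Complex.norm_exp]; simp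
  have h0 : Real.exp (-s ^ 2 / 2) ≤ 1 := Real.exp_le_one_iff.2 (by nlinarith [sq_nonneg s])
  have h1 : 1 - s ^ 2 / 2 ≤ Real.exp (-s ^ 2 / 2) := by
    linarith [Real.add_one_le_exp (-s ^ 2 / 2)]
  have hx := abs_nonneg x
  rcases le_total 1 (s ^ 2) with h | h
  · rw [min_eq_left h, mul_one]
    refine pow_le_pow_left₀ (norm_nonneg _) ((norm_sub_le _ _).trans ?_) 2
    rw [e1, Complex.norm_real, Real.norm_eq_abs, abs_of_pos (Real.exp_pos _)]
    linarith
  · rw [min_eq_right h, ← sq_abs s, ← mul_pow]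
    refine pow_le_pow_left₀ (norm_nonneg _) ?_ 2
    have h2 : ‖Complex.exp (Complex.I * s * x) - 1‖ ≤ |s| * |x| := by
      have := Real.norm_exp_I_mul_ofReal_sub_one_le (x := s * x)
      rwa [Complex.ofReal_mul, ← mul_assoc, Real.norm_eq_abs, abs_mul] at this
    have h3 : ‖(1 : ℂ) - (Real.exp (-s ^ 2 / 2) : ℂ)‖ ≤ s ^ 2 / 2 := by
      rw [← Complex.ofReal_one, ← Complex.ofReal_sub, Complex.norm_real, Real.norm_eq_abs,
        abs_of_nonneg (by linarith)]
      linarith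
    have h4 : s ^ 2 ≤ |s| := by
      rw [← sq_abs] at h ⊢
      nlinarith [abs_nonneg s]
    calc _ = ‖(Complex.exp (Complex.I * s * x) - 1) + (1 - (Real.exp (-s ^ 2 / 2) : ℂ))‖ := by
          rw [sub_add_sub_cancel, sq_abs]
      _ ≤ |s| * |x| + s ^ 2 / 2 := (norm_add_le _ _).trans (add_le_add h2 h3)
      _ ≤ (|x| + 2) * |s| := by nlinarith [abs_nonneg s]

lemma toL2_of_memLp {c : ℝ} {f : ℝ × ℝ → ℂ} (hf : MemLp f 2 (weightMeasure c)) :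
    toL2 c f = hf.toLp f := dif_pos hf

lemma toL2_const_mul {c : ℝ} {f : ℝ × ℝ → ℂ} (hf : MemLp f 2 (weightMeasure c)) (k : ℂ) :
    toL2 c (fun p => k * f p) = k • toL2 c f := by
  rw [toL2_of_memLp hf, toL2_of_memLp (hf.const_mul k), ← MemLp.toLp_const_smul]
  rfl

lemma secondCountableTopology_L2Weight (c : ℝ) : SecondCountableTopology (L2Weight c) := by
  have := sFinite_weightMeasure c
  have : Fact ((2 : ℝ≥0∞) ≠ ⊤) := ⟨by simp⟩
  infer_instance

/-- Distances to fixed points determine measurability in a separable metric space. -/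
lemma measurable_of_edist {α E : Type*} [MeasurableSpace α] [PseudoEMetricSpace E]
    [SecondCountableTopology E] [MeasurableSpace E] [BorelSpace E] {φ : α → E}
    (h : ∀ y, Measurable fun x => edist (φ x) y) : Measurable φ := by
  refine measurable_of_isOpen fun U hU => ?_
  have hball : ∀ y : U, ∃ ε > 0, Metric.eball (y : E) ε ⊆ U := fun y =>
    EMetric.isOpen_iff.1 hU y y.2
  choose ε hε hsub using hball
  obtain ⟨T, hT, hTU⟩ := TopologicalSpace.isOpen_iUnion_countable
    (fun y : U => Metric.eball (y : E) (ε y)) fun y => Metric.isOpen_eball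
  have hU' : U = ⋃ y ∈ T, Metric.eball (y : E) (ε y) := by
    rw [hTU]
    refine Set.Subset.antisymm (fun y hy => ?_) (Set.iUnion_subset fun y => hsub y)
    exact Set.mem_iUnion.2 ⟨⟨y, hy⟩, Metric.mem_eball_self (hε _)⟩
  rw [hU', Set.preimage_iUnion₂]
  exact MeasurableSet.biUnion hT fun y _ => measurableSet_lt (h y) measurable_const

/-- A jointly measurable family of square-integrable functions is a measurable map into the
separable space `L²(ω)`, because distances to fixed elements are integrals over the second
variable. -/
lemma measurable_toL2 {c : ℝ} {α : Type*} [MeasurableSpace α] {f : α → ℝ × ℝ → ℂ}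
    (hf : Measurable (Function.uncurry f)) (hm : ∀ x, MemLp (f x) 2 (weightMeasure c)) :
    Measurable fun x => toL2 c (f x) := by
  have := sFinite_weightMeasure c
  have := secondCountableTopology_L2Weight c
  refine measurable_of_edist fun y => ?_
  have h1 : ∀ x, edist (toL2 c (f x)) y =
      (∫⁻ p, ‖f x p - y p‖ₑ ^ 2 ∂(weightMeasure c)) ^ ((2 : ℝ)⁻¹) := by
    intro x
    rw [toL2_of_memLp (hm x), Lp.edist_def, ← eLpNorm_two_sq, ← ENNReal.rpow_natCast,
      ← ENNReal.rpow_mul]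
    norm_num
    refine eLpNorm_congr_ae ?_
    filter_upwards [(hm x).coeFn_toLp] with p hp
    simp [hp]
  simp_rw [h1]
  have hy : Measurable (y : ℝ × ℝ → ℂ) := (Lp.stronglyMeasurable y).measurable
  refine Measurable.pow_const (Measurable.lintegral_prod_right'
    (f := fun q : α × (ℝ × ℝ) => ‖f q.1 q.2 - y q.2‖ₑ ^ 2) ?_) _
  exact ((hf.sub (hy.comp measurable_snd)).enorm).pow_const 2

/-! ### The empirical characteristic function in L² -/

section TimeSeries

variable {Ω : Type*} [MeasurableSpace Ω] {P : Measure Ω} {X : ℕ → Ω → ℝ} {D : ℝ} {L : ℝ → ℝ}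

/-- The norm in `L²((c s²)⁻¹ ds)` of the error made when the empirical characteristic function,
centred, is replaced by its first-order Hermite term. -/
noncomputable def reductionError (P : Measure Ω) (X : ℕ → Ω → ℝ) (c : ℝ) (n : ℕ) (w : Ω) : ℝ≥0∞ :=
  eLpNorm (fun s => empCharFun X n w s - marginalCharFun P X s - J₁ s * (sampleMean X n w : ℂ)) 2
    (lineWeight c)

lemma memLp_mean_cexp_sub {c : ℝ} (hc : 0 < c) {n : ℕ} (hn : 1 ≤ n) (x : ℕ → ℝ) :
    MemLp (fun s : ℝ => (∑ j ∈ Finset.range n, Complex.exp (Complex.I * s * x j)) / n -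
      (Real.exp (-s ^ 2 / 2) : ℂ)) 2 (lineWeight c) := by
  have h1 := (memLp_finsetSum (Finset.range n) fun j _ => memLp_cexp_sub hc (x j)).const_mul
    ((n : ℂ)⁻¹)
  convert! h1 using 2 with s
  have hn0 : (n : ℂ) ≠ 0 := by exact_mod_cast (by omega : n ≠ 0)
  rw [Finset.sum_sub_distrib, Finset.sum_const, Finset.card_range, nsmul_eq_mul]
  field_simp

lemma IsStandardLRDGaussian.memLp_empCharFun_sub (hX : IsStandardLRDGaussian P X D L) {c : ℝ}
    (hc : 0 < c) {n : ℕ} (hn : 1 ≤ n) (w : Ω) :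
    MemLp (fun s => empCharFun X n w s - marginalCharFun P X s) 2 (lineWeight c) := by
  simp only [hX.marginalCharFun_eq, empCharFun]
  exact memLp_mean_cexp_sub hc hn fun j => X j w

lemma IsStandardLRDGaussian.empCharFun_sub_eq (hX : IsStandardLRDGaussian P X D L) {n : ℕ}
    (hn : 1 ≤ n) (w : Ω) (s : ℝ) :
    empCharFun X n w s - marginalCharFun P X s - J₁ s * (sampleMean X n w : ℂ) =
      (∑ j ∈ Finset.range n, hermiteRemainder s (X j w)) / n := by
  have hn0 : (n : ℂ) ≠ 0 := by exact_mod_cast (by omega : n ≠ 0)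
  simp only [hX.marginalCharFun_eq, empCharFun, sampleMean, hermiteRemainder,
    Finset.sum_sub_distrib, Finset.sum_const, Finset.card_range, nsmul_eq_mul, ← Finset.mul_sum]
  push_cast
  field_simp

lemma IsStandardLRDGaussian.reductionError_sq (hX : IsStandardLRDGaussian P X D L) (c : ℝ)
    {n : ℕ} (hn : 1 ≤ n) (w : Ω) :
    reductionError P X c n w ^ 2 =
      ∫⁻ s, ‖(∑ j ∈ Finset.range n, hermiteRemainder s (X j w)) / (n : ℂ)‖ₑ ^ 2
        ∂(lineWeight c) := by
  rw [reductionError, eLpNorm_two_sq]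
  simp_rw [hX.empCharFun_sub_eq hn]

lemma aemeasurable_hermiteRemainder {μ : Measure (Ω × ℝ)} {W : Ω × ℝ → ℝ}
    (hW : AEMeasurable W μ) : AEMeasurable (fun q : Ω × ℝ => hermiteRemainder q.2 (W q)) μ := by
  unfold hermiteRemainder J₁
  fun_prop

lemma IsStandardLRDGaussian.aemeasurable_remainder (hX : IsStandardLRDGaussian P X D L) (c : ℝ)
    (n : ℕ) : AEMeasurable (fun q : Ω × ℝ =>
      ‖(∑ j ∈ Finset.range n, hermiteRemainder q.2 (X j q.1)) / (n : ℂ)‖ₑ ^ 2)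
      (P.prod (lineWeight c)) := by
  have h : ∀ j, AEMeasurable (fun q : Ω × ℝ => hermiteRemainder q.2 (X j q.1))
      (P.prod (lineWeight c)) := by
    intro j
    exact aemeasurable_hermiteRemainder (hX.aemeasurable j).comp_fst
  have h2 : AEMeasurable (fun q : Ω × ℝ => ∑ j ∈ Finset.range n, hermiteRemainder q.2 (X j q.1))
      (P.prod (lineWeight c)) := by
    fun_prop
  have h3 : AEMeasurable (fun q : Ω × ℝ =>
      (∑ j ∈ Finset.range n, hermiteRemainder q.2 (X j q.1)) / (n : ℂ)) (P.prod (lineWeight c)) :=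
    h2.div_const _
  exact h3.enorm.pow_const (2 : ℕ)

lemma IsStandardLRDGaussian.aemeasurable_reductionError (hX : IsStandardLRDGaussian P X D L)
    (c : ℝ) {n : ℕ} (hn : 1 ≤ n) : AEMeasurable (reductionError P X c n) P := by
  have h : reductionError P X c n = fun w => (∫⁻ s, ‖(∑ j ∈ Finset.range n,
      hermiteRemainder s (X j w)) / (n : ℂ)‖ₑ ^ 2 ∂(lineWeight c)) ^ ((2 : ℝ)⁻¹) := by
    funext w
    rw [← hX.reductionError_sq c hn, ← ENNReal.rpow_natCast, ← ENNReal.rpow_mul]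
    simp
  rw [h]
  exact (hX.aemeasurable_remainder c n).lintegral_prod_right'.pow_const _

variable [IsProbabilityMeasure P]

lemma IsStandardLRDGaussian.lintegral_enorm_remainder_sq_le (hX : IsStandardLRDGaussian P X D L)
    (n : ℕ) (s : ℝ) :
    ∫⁻ w, ‖(∑ j ∈ Finset.range n, hermiteRemainder s (X j w)) / (n : ℂ)‖ₑ ^ 2 ∂P ≤
      ENNReal.ofReal ((∑ i ∈ Finset.range n, ∑ j ∈ Finset.range n,
        cov[X 0, X (Nat.dist i j); P] ^ 2) / (n : ℝ) ^ 2 * min 1 (s ^ 2)) := by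
  set G : Ω → ℂ := fun w => (∑ j ∈ Finset.range n, hermiteRemainder s (X j w)) / (n : ℂ) with hG
  have hpair := fun i j : ℕ => integral_hermiteRemainder_mul_conj
    (hX.gaussian.hasGaussianLaw_prodMk (s := i) (t := j)) (hX.integral_eq_zero i)
    (hX.integral_eq_zero j) (hX.variance_eq_one i) (hX.variance_eq_one j) s
  have hGG : ∀ w, ((‖G w‖ ^ 2 : ℝ) : ℂ) = ((n : ℂ) ^ 2)⁻¹ * ∑ i ∈ Finset.range n,
      ∑ j ∈ Finset.range n,
        hermiteRemainder s (X i w) * (starRingEnd ℂ) (hermiteRemainder s (X j w)) := by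
    intro w
    rw [Complex.ofReal_pow, ← Complex.mul_conj', hG, map_div₀, map_sum, map_natCast,
      div_mul_div_comm, Finset.sum_mul_sum, ← sq, div_eq_inv_mul]
  have hint : Integrable (fun w => ((‖G w‖ ^ 2 : ℝ) : ℂ)) P := by
    simp_rw [hGG]
    exact (integrable_finsetSum _ fun i _ => integrable_finsetSum _ fun j _ =>
      (hpair i j).1).const_mul _
  have hint' : Integrable (fun w => ‖G w‖ ^ 2) P := by
    simpa only [RCLike.re_eq_complex_re, Complex.ofReal_re] using hint.re
  have hval : ∫ w, ‖G w‖ ^ 2 ∂P = ((n : ℝ) ^ 2)⁻¹ * ∑ i ∈ Finset.range n, ∑ j ∈ Finset.range n,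
      remainderCov s cov[X i, X j; P] := by
    apply Complex.ofReal_injective
    rw [← integral_complex_ofReal]
    simp_rw [hGG]
    rw [integral_const_mul, integral_finsetSum _ fun i _ => integrable_finsetSum _ fun j _ =>
      (hpair i j).1]
    simp_rw [integral_finsetSum _ fun j _ => (hpair _ j).1, (hpair _ _).2]
    push_cast
    rfl
  simp_rw [enorm_sq_eq_ofReal]
  rw [← ofReal_integral_eq_lintegral_ofReal hint' (ae_of_all _ fun w => by positivity), hval]
  refine ENNReal.ofReal_le_ofReal ?_
  rw [div_eq_inv_mul, mul_assoc]
  refine mul_le_mul_of_nonneg_left ?_ (by positivity)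
  rw [Finset.sum_mul]
  refine Finset.sum_le_sum fun i _ => ?_
  rw [Finset.sum_mul]
  refine Finset.sum_le_sum fun j _ => ?_
  rw [← hX.cov_eq_natDist]
  exact remainderCov_le (hX.abs_cov_le_one i j)

lemma IsStandardLRDGaussian.lintegral_reductionError_sq_le (hX : IsStandardLRDGaussian P X D L)
    {c : ℝ} (hc : 0 < c) {n : ℕ} (hn : 1 ≤ n) :
    ∫⁻ w, reductionError P X c n w ^ 2 ∂P ≤ ENNReal.ofReal
      ((∑ i ∈ Finset.range n, ∑ j ∈ Finset.range n, cov[X 0, X (Nat.dist i j); P] ^ 2) /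
        (n : ℝ) ^ 2 * (∫⁻ s, ENNReal.ofReal (min 1 (s ^ 2)) ∂(lineWeight c)).toReal) := by
  simp_rw [hX.reductionError_sq c hn]
  rw [lintegral_lintegral_swap (hX.aemeasurable_remainder c n),
    ENNReal.ofReal_mul (by positivity), ENNReal.ofReal_toReal (lintegral_min_lineWeight_ne_top hc),
    ← lintegral_const_mul _ (by fun_prop)]
  refine lintegral_mono fun s => ?_
  rw [← ENNReal.ofReal_mul (by positivity)]
  exact hX.lintegral_enorm_remainder_sq_le n s

/-- The mean square reduction error is negligible compared with `n ^ (-D) L n`. -/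
lemma IsStandardLRDGaussian.exists_reductionError_bound (hX : IsStandardLRDGaussian P X D L)
    {c : ℝ} (hc : 0 < c) : ∃ α : ℕ → ℝ, (∀ n, 0 ≤ α n) ∧
      (∀ n, 1 ≤ n → ∫⁻ w, reductionError P X c n w ^ 2 ∂P ≤ ENNReal.ofReal (α n)) ∧
      Tendsto (fun n : ℕ => α n / ((n : ℝ) ^ (-D) * L n)) atTop (𝓝 0) := by
  refine ⟨_, fun n => ?_, fun n hn => hX.lintegral_reductionError_sq_le hc hn, ?_⟩
  · positivity
  · have h := (tendsto_sum_sum_autocov_sq hX.param_pos hX.param_lt_one hX.slowlyVarying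
      hX.cov_lag).mul_const (∫⁻ s, ENNReal.ofReal (min 1 (s ^ 2)) ∂(lineWeight c)).toReal
    rw [zero_mul] at h
    refine h.congr' ?_
    filter_upwards [eventually_gt_atTop 0] with n hn
    rw [rpow_two_sub_mul_eq (by exact_mod_cast hn)]
    ring

/-- The mean square norm of the first-order Hermite term is of order `n ^ (-D) L n`. -/
lemma IsStandardLRDGaussian.exists_linearTerm_bound (hX : IsStandardLRDGaussian P X D L)
    {c : ℝ} (hc : 0 < c) : ∃ β : ℕ → ℝ, ∃ b : ℝ, (∀ n, 0 ≤ β n) ∧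
      (∀ n, ∫⁻ w, (eLpNorm J₁ 2 (lineWeight c) * ‖(sampleMean X n w : ℂ)‖ₑ) ^ 2 ∂P ≤
        ENNReal.ofReal (β n)) ∧
      Tendsto (fun n : ℕ => β n / ((n : ℝ) ^ (-D) * L n)) atTop (𝓝 b) := by
  refine ⟨fun n => (eLpNorm J₁ 2 (lineWeight c) ^ 2).toReal * Var[sampleMean X n; P],
    (eLpNorm J₁ 2 (lineWeight c) ^ 2).toReal * limitVar D,
    fun n => mul_nonneg ENNReal.toReal_nonneg (variance_nonneg _ _), fun n => ?_, ?_⟩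
  · have hG := hX.hasGaussianLaw_sampleMean n
    have hne : eLpNorm J₁ 2 (lineWeight c) ^ 2 ≠ ⊤ := ENNReal.pow_ne_top (memLp_J₁ hc).2.ne
    rw [ENNReal.ofReal_mul ENNReal.toReal_nonneg, ENNReal.ofReal_toReal hne]
    simp_rw [mul_pow]
    rw [lintegral_const_mul' _ _ hne]
    gcongr
    rw [variance_eq_integral hG.aemeasurable, hX.integral_sampleMean,
      ofReal_integral_eq_lintegral_ofReal (by simpa using hG.memLp_two.integrable_sq)
        (ae_of_all _ fun w => by positivity)]
    refine lintegral_mono fun w => ?_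
    rw [enorm_sq_eq_ofReal, Complex.norm_real, Real.norm_eq_abs, sq_abs, sub_zero]
  · simp_rw [mul_div_assoc]
    exact hX.tendsto_variance_sampleMean.const_mul _

end TimeSeries

/-! ### The reduction to the sample means -/

lemma lintegral_mul_le_sqrt {Ω : Type*} [MeasurableSpace Ω] {P : Measure Ω} {U V : Ω → ℝ≥0∞}
    (hU : AEMeasurable U P) (hV : AEMeasurable V P) {a b : ℝ} (ha : 0 ≤ a) (hb : 0 ≤ b)
    (hUa : ∫⁻ w, U w ^ 2 ∂P ≤ ENNReal.ofReal a) (hVb : ∫⁻ w, V w ^ 2 ∂P ≤ ENNReal.ofReal b) :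
    ∫⁻ w, U w * V w ∂P ≤ ENNReal.ofReal (√(a * b)) := by
  have h := ENNReal.lintegral_mul_le_Lp_mul_Lq P Real.HolderConjugate.two_two hU hV
  simp only [Pi.mul_apply, ENNReal.rpow_ofNat] at h
  refine h.trans ?_
  rw [Real.sqrt_mul ha, ENNReal.ofReal_mul (Real.sqrt_nonneg _), Real.sqrt_eq_rpow,
    Real.sqrt_eq_rpow, ← ENNReal.ofReal_rpow_of_nonneg ha (by norm_num)]
  rw [← ENNReal.ofReal_rpow_of_nonneg hb (by norm_num)]
  exact mul_le_mul' (ENNReal.rpow_le_rpow hUa (by norm_num))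
    (ENNReal.rpow_le_rpow hVb (by norm_num))

section TimeSeries

variable {Ω : Type*} [MeasurableSpace Ω] {P : Measure Ω} {X Y : ℕ → Ω → ℝ} {D_X D_Y : ℝ}
  {L_X L_Y : ℝ → ℝ} {c : ℝ}

lemma memLp_tensor (hc : 0 < c) {f g : ℝ → ℂ} (hf : MemLp f 2 (lineWeight c))
    (hg : MemLp g 2 (lineWeight c)) :
    MemLp (fun p : ℝ × ℝ => f p.1 * g p.2) 2 (weightMeasure c) := by
  rw [weightMeasure_eq_prod hc]
  refine ⟨hf.1.comp_fst.mul hg.1.comp_snd, ?_⟩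
  rw [eLpNorm_tensor hf.1 hg.1]
  exact ENNReal.mul_lt_top hf.2 hg.2

lemma memLp_ecfProduct (hc : 0 < c) (hX : IsStandardLRDGaussian P X D_X L_X)
    (hY : IsStandardLRDGaussian P Y D_Y L_Y) {n : ℕ} (hn : 1 ≤ n) (w : Ω) :
    MemLp (ecfProduct P X Y n w) 2 (weightMeasure c) := by
  have := memLp_tensor hc (hX.memLp_empCharFun_sub hc hn w) (hY.memLp_empCharFun_sub hc hn w)
  convert! this using 2 with p
  rw [ecfProduct, mul_comm]

lemma memLp_J₁_tensor (hc : 0 < c) :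
    MemLp (fun p : ℝ × ℝ => J₁ p.1 * J₁ p.2) 2 (weightMeasure c) :=
  memLp_tensor hc (memLp_J₁ hc) (memLp_J₁ hc)

/-- With `A = a + α` and `B = b + β`, the error `A ⊗ B - a ⊗ b` splits into
`α ⊗ β + α ⊗ b + a ⊗ β`. -/
lemma eLpNorm_ecfProduct_sub_le (hc : 0 < c) (hX : IsStandardLRDGaussian P X D_X L_X)
    (hY : IsStandardLRDGaussian P Y D_Y L_Y) {n : ℕ} (hn : 1 ≤ n) (w : Ω) :
    eLpNorm (fun p : ℝ × ℝ => ecfProduct P X Y n w p -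
      J₁ p.1 * (sampleMean X n w : ℂ) * (J₁ p.2 * (sampleMean Y n w : ℂ))) 2 (weightMeasure c) ≤
      reductionError P X c n w * reductionError P Y c n w +
      reductionError P X c n w * (eLpNorm J₁ 2 (lineWeight c) * ‖(sampleMean Y n w : ℂ)‖ₑ) +
      (eLpNorm J₁ 2 (lineWeight c) * ‖(sampleMean X n w : ℂ)‖ₑ) * reductionError P Y c n w := by
  have hJ : ∀ z : ℂ, MemLp (fun s => J₁ s * z) 2 (lineWeight c) := fun z =>
    (memLp_J₁ hc).mul_const z
  have hJn : ∀ z : ℂ, eLpNorm (fun s => J₁ s * z) 2 (lineWeight c) =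
      eLpNorm J₁ 2 (lineWeight c) * ‖z‖ₑ := by
    intro z
    rw [mul_comm, ← eLpNorm_const_smul]
    refine eLpNorm_congr_ae (ae_of_all _ fun s => ?_)
    simp [mul_comm]
  have hα := (hX.memLp_empCharFun_sub hc hn w).sub (hJ (sampleMean X n w))
  have hβ := (hY.memLp_empCharFun_sub hc hn w).sub (hJ (sampleMean Y n w))
  set α : ℝ → ℂ := fun s => empCharFun X n w s - marginalCharFun P X s -
    J₁ s * (sampleMean X n w : ℂ) with hαdef
  set β : ℝ → ℂ := fun s => empCharFun Y n w s - marginalCharFun P Y s -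
    J₁ s * (sampleMean Y n w : ℂ) with hβdef
  set a : ℝ → ℂ := fun s => J₁ s * (sampleMean X n w : ℂ)
  set b : ℝ → ℂ := fun s => J₁ s * (sampleMean Y n w : ℂ)
  have hα' : MemLp α 2 (lineWeight c) := hα
  have hβ' : MemLp β 2 (lineWeight c) := hβ
  have hsplit : (fun p : ℝ × ℝ => ecfProduct P X Y n w p - a p.1 * b p.2) =
      ((fun p : ℝ × ℝ => α p.1 * β p.2) + fun p => α p.1 * b p.2) + fun p => a p.1 * β p.2 := by
    funext p
    simp only [ecfProduct, Pi.add_apply, hαdef, hβdef, a, b]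
    ring
  change eLpNorm (fun p : ℝ × ℝ => ecfProduct P X Y n w p - a p.1 * b p.2) 2 _ ≤ _
  rw [hsplit]
  have t1 := memLp_tensor hc hα' hβ'
  have t2 := memLp_tensor hc hα' (hJ (sampleMean Y n w))
  have t3 := memLp_tensor hc (hJ (sampleMean X n w)) hβ'
  refine (eLpNorm_add_le (t1.1.add t2.1) t3.1 one_le_two).trans ?_
  refine add_le_add ((eLpNorm_add_le t1.1 t2.1 one_le_two).trans (add_le_add ?_ ?_)) ?_
  · rw [weightMeasure_eq_prod hc, eLpNorm_tensor hα'.1 hβ'.1]; rfl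
  · rw [weightMeasure_eq_prod hc, eLpNorm_tensor hα'.1 (hJ _).1, hJn]; rfl
  · rw [weightMeasure_eq_prod hc, eLpNorm_tensor (hJ _).1 hβ'.1, hJn]; rfl

/-- Both normalizing factors, the one of the reduction and its inverse in the weak limit, in terms
of the variance rates `n ^ (-D) L n`; this needs `L_X n` and `L_Y n` to be positive. -/
lemma normalization_eq_sqrt (hX : SlowlyVarying L_X) (hY : SlowlyVarying L_Y) :
    ∀ᶠ n : ℕ in atTop, 0 < (n : ℝ) ^ (-D_X) * L_X n ∧ 0 < (n : ℝ) ^ (-D_Y) * L_Y n ∧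
      (n : ℝ) ^ (-((D_X + D_Y) / 2)) * L_X n ^ (1 / 2 : ℝ) * L_Y n ^ (1 / 2 : ℝ) =
        √((n : ℝ) ^ (-D_X) * L_X n) * √((n : ℝ) ^ (-D_Y) * L_Y n) ∧
      (n : ℝ) ^ ((D_X + D_Y) / 2) * L_X n ^ (-(1 / 2) : ℝ) * L_Y n ^ (-(1 / 2) : ℝ) =
        (√((n : ℝ) ^ (-D_X) * L_X n) * √((n : ℝ) ^ (-D_Y) * L_Y n))⁻¹ := by
  filter_upwards [tendsto_natCast_atTop_atTop.eventually hX.eventually_pos,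
    tendsto_natCast_atTop_atTop.eventually hY.eventually_pos, eventually_gt_atTop 0] with n h1 h2 h3
  have hn : (0 : ℝ) < n := by exact_mod_cast h3
  have hmain : (n : ℝ) ^ (-((D_X + D_Y) / 2)) * L_X n ^ (1 / 2 : ℝ) * L_Y n ^ (1 / 2 : ℝ) =
        √((n : ℝ) ^ (-D_X) * L_X n) * √((n : ℝ) ^ (-D_Y) * L_Y n) := by
    rw [Real.sqrt_eq_rpow, Real.sqrt_eq_rpow, Real.mul_rpow (by positivity) h1.le,
      Real.mul_rpow (by positivity) h2.le, ← Real.rpow_mul hn.le, ← Real.rpow_mul hn.le,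
      show -((D_X + D_Y) / 2) = -D_X * (1 / 2) + -D_Y * (1 / 2) by ring, Real.rpow_add hn]
    ring
  refine ⟨by positivity, by positivity, hmain, ?_⟩
  rw [← hmain, Real.rpow_neg hn.le, Real.rpow_neg h1.le, Real.rpow_neg h2.le, mul_inv, mul_inv,
    inv_inv]

variable [IsProbabilityMeasure P]

theorem isLittleOP_ecfProduct_sub (hc : 0 < c) (hX : IsStandardLRDGaussian P X D_X L_X)
    (hY : IsStandardLRDGaussian P Y D_Y L_Y) :
    IsLittleOP P (fun n w => eLpNorm (fun p : ℝ × ℝ => ecfProduct P X Y n w p -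
      J₁ p.1 * (sampleMean X n w : ℂ) * (J₁ p.2 * (sampleMean Y n w : ℂ))) 2 (weightMeasure c))
      (fun n => (n : ℝ) ^ (-((D_X + D_Y) / 2)) * L_X n ^ (1 / 2 : ℝ) * L_Y n ^ (1 / 2 : ℝ)) := by
  intro ε hε
  obtain ⟨αX, hαX0, hαX, hαXlim⟩ := hX.exists_reductionError_bound hc
  obtain ⟨αY, hαY0, hαY, hαYlim⟩ := hY.exists_reductionError_bound hc
  obtain ⟨βX, bX, hβX0, hβX, hβXlim⟩ := hX.exists_linearTerm_bound hc
  obtain ⟨βY, bY, hβY0, hβY, hβYlim⟩ := hY.exists_linearTerm_bound hc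
  set B : ℕ → ℝ := fun n => √(αX n * αY n) + √(αX n * βY n) + √(βX n * αY n) with hB
  set rX : ℕ → ℝ := fun n => (n : ℝ) ^ (-D_X) * L_X n with hrX
  set rY : ℕ → ℝ := fun n => (n : ℝ) ^ (-D_Y) * L_Y n with hrY
  have hnorm := normalization_eq_sqrt (D_X := D_X) (D_Y := D_Y) hX.slowlyVarying hY.slowlyVarying
  have hBlim : Tendsto (fun n => ε⁻¹ * (B n / (√(rX n) * √(rY n)))) atTop (𝓝 0) := by
    have h1 := (hαXlim.mul hαYlim).sqrt
    have h2 := (hαXlim.mul hβYlim).sqrt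
    have h3 := (hβXlim.mul hαYlim).sqrt
    have h4 := ((h1.add h2).add h3).const_mul ε⁻¹
    simp only [zero_mul, mul_zero, Real.sqrt_zero, add_zero] at h4
    refine h4.congr' ?_
    filter_upwards [hnorm] with n hn
    have hrx : 0 < rX n := hn.1
    have hry : 0 < rY n := hn.2.1
    have hs : ∀ x y : ℝ, √(x / rX n * (y / rY n)) = √(x * y) / (√(rX n) * √(rY n)) := by
      intro x y
      rw [← Real.sqrt_mul hrx.le, div_mul_div_comm, Real.sqrt_div' _ (by positivity)]
    simp only [hrX, hrY] at hs
    rw [hs, hs, hs, hB, add_div, add_div]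
  have hlim : Tendsto (fun n => ENNReal.ofReal (ε⁻¹ * (B n / (√(rX n) * √(rY n)))))
      atTop (𝓝 0) := by
    rw [← ENNReal.ofReal_zero]
    exact (ENNReal.continuous_ofReal.tendsto 0).comp hBlim
  refine tendsto_of_tendsto_of_tendsto_of_le_of_le' tendsto_const_nhds hlim
    (Eventually.of_forall fun _ => zero_le) ?_
  filter_upwards [hnorm, eventually_ge_atTop 1] with n hn hn1
  have ha : 0 < √(rX n) * √(rY n) := mul_pos (Real.sqrt_pos.2 hn.1) (Real.sqrt_pos.2 hn.2.1)
  rw [hn.2.2.1]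
  have mX := hX.aemeasurable_reductionError c hn1
  have mY := hY.aemeasurable_reductionError c hn1
  have mX' : AEMeasurable (fun w => eLpNorm J₁ 2 (lineWeight c) * ‖(sampleMean X n w : ℂ)‖ₑ) P := by
    have := (hX.hasGaussianLaw_sampleMean n).aemeasurable
    fun_prop
  have mY' : AEMeasurable (fun w => eLpNorm J₁ 2 (lineWeight c) * ‖(sampleMean Y n w : ℂ)‖ₑ) P := by
    have := (hY.hasGaussianLaw_sampleMean n).aemeasurable
    fun_prop
  have m1 : AEMeasurable (fun w => reductionError P X c n w * reductionError P Y c n w) P :=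
    mX.mul mY
  have m2 : AEMeasurable (fun w => reductionError P X c n w *
      (eLpNorm J₁ 2 (lineWeight c) * ‖(sampleMean Y n w : ℂ)‖ₑ)) P := mX.mul mY'
  have m12 := m1.add m2
  set F : Ω → ℝ≥0∞ := fun w => reductionError P X c n w * reductionError P Y c n w +
      reductionError P X c n w * (eLpNorm J₁ 2 (lineWeight c) * ‖(sampleMean Y n w : ℂ)‖ₑ) +
      (eLpNorm J₁ 2 (lineWeight c) * ‖(sampleMean X n w : ℂ)‖ₑ) * reductionError P Y c n w
  have hF : AEMeasurable F P := m12.add (mX'.mul mY)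
  have hFB : ∫⁻ w, F w ∂P ≤ ENNReal.ofReal (B n) := by
    refine (lintegral_add_left' m12 _).trans_le ?_
    simp only [Pi.add_apply]
    rw [lintegral_add_left' m1, hB,
      ENNReal.ofReal_add (by positivity) (by positivity),
      ENNReal.ofReal_add (by positivity) (by positivity)]
    exact add_le_add (add_le_add
      (lintegral_mul_le_sqrt mX mY (hαX0 n) (hαY0 n) (hαX n hn1) (hαY n hn1))
      (lintegral_mul_le_sqrt mX mY' (hαX0 n) (hβY0 n) (hαX n hn1) (hβY n)))
      (lintegral_mul_le_sqrt mX' mY (hβX0 n) (hαY0 n) (hβX n) (hαY n hn1))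
  have hM := mul_meas_ge_le_lintegral₀ hF (ENNReal.ofReal (ε * (√(rX n) * √(rY n))))
  calc _ ≤ P {w | ENNReal.ofReal (ε * (√(rX n) * √(rY n))) ≤ F w} :=
        measure_mono fun w hw => le_trans hw (eLpNorm_ecfProduct_sub_le hc hX hY hn1 w)
    _ ≤ ENNReal.ofReal (B n) / ENNReal.ofReal (ε * (√(rX n) * √(rY n))) := by
        rw [ENNReal.le_div_iff_mul_le (Or.inl (by simpa using by positivity))
          (Or.inl ENNReal.ofReal_ne_top), mul_comm]
        exact hM.trans hFB
    _ = ENNReal.ofReal (ε⁻¹ * (B n / (√(rX n) * √(rY n)))) := by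
        rw [← ENNReal.ofReal_div_of_pos (by positivity)]
        congr 1
        field_simp

end TimeSeries

/-! ### Weak convergence -/

/-- Convergence in distribution depends on the laws only. -/
lemma tendstoInDistribution_of_identDistrib_seq {Ω Ω' E : Type*} [MeasurableSpace Ω]
    [MeasurableSpace Ω'] {P : Measure Ω} [IsProbabilityMeasure P] {P' : Measure Ω'}
    [IsProbabilityMeasure P'] [TopologicalSpace E] [MeasurableSpace E] [OpensMeasurableSpace E]
    {U : ℕ → Ω → E} {V : ℕ → Ω' → E} {Z : Ω' → E} (h : ∀ n, IdentDistrib (U n) (V n) P P')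
    (hV : TendstoInDistribution V atTop Z (fun _ => P') P') :
    TendstoInDistribution U atTop Z (fun _ => P) P' where
  forall_aemeasurable n := (h n).aemeasurable_fst
  aemeasurable_limit := hV.aemeasurable_limit
  tendsto := hV.tendsto.congr fun n => Subtype.ext (h n).map_eq.symm

section TimeSeries

variable {Ω : Type*} [MeasurableSpace Ω] {P : Measure Ω} {X Y : ℕ → Ω → ℝ} {D_X D_Y : ℝ}
  {L_X L_Y : ℝ → ℝ} {c : ℝ}

lemma J₁_mul_J₁ (s t : ℝ) :
    J₁ s * J₁ t = ((-(s * t * Real.exp (-(s ^ 2 + t ^ 2) / 2)) : ℝ) : ℂ) := by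
  have h : Real.exp (-(s ^ 2 + t ^ 2) / 2) = Real.exp (-s ^ 2 / 2) * Real.exp (-t ^ 2 / 2) := by
    rw [← Real.exp_add]; congr 1; ring
  simp only [J₁, h, Complex.ofReal_neg, Complex.ofReal_mul]
  linear_combination ((Real.exp (-s ^ 2 / 2) : ℂ) * s * Real.exp (-t ^ 2 / 2) * t) * Complex.I_sq

/-- The class of `ecfProduct` in `L²(ω)` is a measurable function of the two sequences of
observations, which are almost everywhere measurable. -/
lemma aemeasurable_toL2_ecfProduct (hc : 0 < c) (hX : IsStandardLRDGaussian P X D_X L_X)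
    (hY : IsStandardLRDGaussian P Y D_Y L_Y) {n : ℕ} (hn : 1 ≤ n) :
    AEMeasurable (fun w => toL2 c (ecfProduct P X Y n w)) P := by
  let f : (ℕ → ℝ) × (ℕ → ℝ) → ℝ × ℝ → ℂ := fun q p =>
    ((∑ j ∈ Finset.range n, Complex.exp (Complex.I * p.2 * q.2 j)) / n -
      (Real.exp (-p.2 ^ 2 / 2) : ℂ)) *
    ((∑ j ∈ Finset.range n, Complex.exp (Complex.I * p.1 * q.1 j)) / n -
      (Real.exp (-p.1 ^ 2 / 2) : ℂ))
  have hf : Measurable (Function.uncurry f) := by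
    simp only [f, Function.uncurry_def]
    fun_prop
  have hfX : ∀ (x y : ℕ → ℝ), MemLp (f (x, y)) 2 (weightMeasure c) := by
    intro x y
    have h := memLp_tensor hc (memLp_mean_cexp_sub hc hn x) (memLp_mean_cexp_sub hc hn y)
    convert! h using 2 with p
    exact mul_comm _ _
  have hm : Measurable fun q => toL2 c (f q) := measurable_toL2 hf fun q => hfX q.1 q.2
  have hw : AEMeasurable (fun w => ((fun j => X j w : ℕ → ℝ), (fun j => Y j w : ℕ → ℝ))) P :=
    (aemeasurable_pi_lambda _ hX.aemeasurable).prodMk (aemeasurable_pi_lambda _ hY.aemeasurable)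
  refine (hm.comp_aemeasurable hw).congr (ae_of_all _ fun w => ?_)
  simp only [Function.comp_apply]
  congr 1
  funext p
  simp only [f, ecfProduct, empCharFun, hX.marginalCharFun_eq, hY.marginalCharFun_eq]

variable [IsProbabilityMeasure P]

/-- A sample mean of Gaussian observations has the law of a rescaled standard normal variable. -/
lemma IsStandardLRDGaussian.identDistrib_sampleMean (hX : IsStandardLRDGaussian P X D_X L_X)
    {Ω' : Type*} [MeasurableSpace Ω'] {P' : Measure Ω'} {Z : Ω' → ℝ}
    (hZ : HasLaw Z (gaussianReal 0 1) P') (n : ℕ) :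
    IdentDistrib (sampleMean X n) (fun w' => √(Var[sampleMean X n; P]) * Z w') P P' := by
  have hG := hX.hasGaussianLaw_sampleMean n
  have h1 : HasLaw (sampleMean X n) (gaussianReal 0 (Var[sampleMean X n; P]).toNNReal) P :=
    ⟨hG.aemeasurable, by rw [hG.map_eq_gaussianReal, hX.integral_sampleMean]⟩
  have h2 := gaussianReal_const_mul hZ (√(Var[sampleMean X n; P]))
  refine h1.identDistrib ?_
  convert! h2 using 2
  · simp
  · ext
    simp [Real.sq_sqrt (variance_nonneg _ _), variance_nonneg]

theorem tendstoInDistribution_ecfProduct (hc : 0 < c) (hX : IsStandardLRDGaussian P X D_X L_X)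
    (hY : IsStandardLRDGaussian P Y D_Y L_Y)
    (hXY : IndepFun (fun w k => X k w) (fun w k => Y k w) P)
    {Ω' : Type*} [MeasurableSpace Ω'] {P' : Measure Ω'} [IsProbabilityMeasure P']
    {Z_X Z_Y : Ω' → ℝ}
    (hZX : HasLaw Z_X (gaussianReal 0 1) P') (hZY : HasLaw Z_Y (gaussianReal 0 1) P')
    (hZ : IndepFun Z_X Z_Y P') :
    TendstoInDistribution
      (fun (n : ℕ) w => toL2 c (fun p : ℝ × ℝ =>
        (((n : ℝ) ^ ((D_X + D_Y) / 2) *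
          L_X n ^ (-(1 / 2) : ℝ) * L_Y n ^ (-(1 / 2) : ℝ) : ℝ) : ℂ) * ecfProduct P X Y n w p))
      atTop
      (fun w' => toL2 c (fun p : ℝ × ℝ =>
        ((-(p.1 * p.2 * Real.exp (-(p.1 ^ 2 + p.2 ^ 2) / 2)) *
          ((√(limitVar D_X) * Z_X w') * (√(limitVar D_Y) * Z_Y w')) : ℝ) : ℂ)))
      (fun _ => P) P' := by
  have := secondCountableTopology_L2Weight c
  set k : ℕ → ℝ := fun n =>
    (n : ℝ) ^ ((D_X + D_Y) / 2) * L_X n ^ (-(1 / 2) : ℝ) * L_Y n ^ (-(1 / 2) : ℝ) with hk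
  have hnorm := normalization_eq_sqrt (D_X := D_X) (D_Y := D_Y) hX.slowlyVarying hY.slowlyVarying
  set G : L2Weight c := toL2 c (fun p : ℝ × ℝ => J₁ p.1 * J₁ p.2) with hG
  have hJ := memLp_J₁_tensor hc
  have hcont : Continuous fun x : ℝ => (x : ℂ) • G := by fun_prop
  have hlimeq : (fun w' => toL2 c (fun p : ℝ × ℝ =>
        ((-(p.1 * p.2 * Real.exp (-(p.1 ^ 2 + p.2 ^ 2) / 2)) *
          ((√(limitVar D_X) * Z_X w') * (√(limitVar D_Y) * Z_Y w')) : ℝ) : ℂ))) =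
      fun w' => (((√(limitVar D_X) * √(limitVar D_Y)) * (Z_X w' * Z_Y w') : ℝ) : ℂ) • G := by
    funext w'
    rw [hG, ← toL2_const_mul hJ]
    congr 1
    funext p
    rw [J₁_mul_J₁, ← Complex.ofReal_mul]
    congr 1
    ring
  rw [hlimeq]
  -- the product of the sample means has the law of a multiple of `Z_X * Z_Y`
  set κ : ℕ → ℝ := fun n => k n * (√(Var[sampleMean X n; P]) * √(Var[sampleMean Y n; P])) with hκ
  have hκlim : Tendsto κ atTop (𝓝 (√(limitVar D_X) * √(limitVar D_Y))) := by
    refine (hX.tendsto_variance_sampleMean.sqrt.mul hY.tendsto_variance_sampleMean.sqrt).congr' ?_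
    filter_upwards [hnorm] with n hn
    rw [hκ, hk]
    simp only
    rw [hn.2.2.2, Real.sqrt_div' _ hn.1.le, Real.sqrt_div' _ hn.2.1.le]
    ring
  have hZm : AEMeasurable (fun w' => Z_X w' * Z_Y w') P' := hZX.aemeasurable.mul hZY.aemeasurable
  have hV : TendstoInDistribution (fun (n : ℕ) w' => ((κ n * (Z_X w' * Z_Y w') : ℝ) : ℂ) • G) atTop
      (fun w' => (((√(limitVar D_X) * √(limitVar D_Y)) * (Z_X w' * Z_Y w') : ℝ) : ℂ) • G)
      (fun _ => P') P' := by
    refine tendstoInDistribution_of_ae_tendsto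
      (fun n => hcont.measurable.comp_aemeasurable (hZm.const_mul _))
      (hcont.measurable.comp_aemeasurable (hZm.const_mul _)) (ae_of_all _ fun w' => ?_)
    exact (hcont.tendsto _).comp (hκlim.mul_const _)
  have hident : ∀ n : ℕ, IdentDistrib
      (fun w => ((k n * (sampleMean X n w * sampleMean Y n w) : ℝ) : ℂ) • G)
      (fun w' => ((κ n * (Z_X w' * Z_Y w') : ℝ) : ℂ) • G) P P' := by
    intro n
    have hmean : Measurable fun x : ℕ → ℝ => (∑ j ∈ Finset.range n, x j) / (n : ℝ) := by fun_prop
    have hind : IndepFun (sampleMean X n) (sampleMean Y n) P := hXY.comp hmean hmean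
    have hpair := (hX.identDistrib_sampleMean hZX n).prodMk (hY.identDistrib_sampleMean hZY n) hind
      (hZ.comp (measurable_const_mul _) (measurable_const_mul _))
    have hu : Measurable fun q : ℝ × ℝ => ((k n * (q.1 * q.2) : ℝ) : ℂ) • G :=
      hcont.measurable.comp (by fun_prop)
    have h3 := hpair.comp hu
    convert! h3 using 1
    funext w'
    simp only [Function.comp_apply, hκ]
    congr 2
    ring
  have hU := tendstoInDistribution_of_identDistrib_seq hident hV
  refine tendstoInDistribution_of_tendstoInMeasure_sub _ _ hU ?_ fun n => ?_
  · rw [tendstoInMeasure_iff_norm]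
    intro ε hε
    have hR := isLittleOP_ecfProduct_sub hc hX hY ε hε
    refine hR.congr' ?_
    filter_upwards [hnorm, eventually_ge_atTop 1] with n hn hn1
    have hr : 0 < √((n : ℝ) ^ (-D_X) * L_X n) * √((n : ℝ) ^ (-D_Y) * L_Y n) :=
      mul_pos (Real.sqrt_pos.2 hn.1) (Real.sqrt_pos.2 hn.2.1)
    have hkn : k n = (√((n : ℝ) ^ (-D_X) * L_X n) * √((n : ℝ) ^ (-D_Y) * L_Y n))⁻¹ := hn.2.2.2
    rw [hn.2.2.1]
    set r := √((n : ℝ) ^ (-D_X) * L_X n) * √((n : ℝ) ^ (-D_Y) * L_Y n)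
    congr 1
    ext w
    have hE := memLp_ecfProduct hc hX hY hn1 w
    have hS := hE.sub (hJ.const_mul ((sampleMean X n w * sampleMean Y n w : ℝ) : ℂ))
    have hfun : (fun p : ℝ × ℝ => ecfProduct P X Y n w p -
        J₁ p.1 * (sampleMean X n w : ℂ) * (J₁ p.2 * (sampleMean Y n w : ℂ))) =
        ecfProduct P X Y n w -
          fun p => ((sampleMean X n w * sampleMean Y n w : ℝ) : ℂ) * (J₁ p.1 * J₁ p.2) := by
      funext p
      simp only [Pi.sub_apply]
      push_cast
      ring
    have hdiff : toL2 c (fun p => (k n : ℂ) * ecfProduct P X Y n w p) -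
        ((k n * (sampleMean X n w * sampleMean Y n w) : ℝ) : ℂ) • G =
        (k n : ℂ) • hS.toLp _ := by
      rw [toL2_const_mul hE, Complex.ofReal_mul (k n), mul_smul, ← smul_sub, hG,
        ← toL2_const_mul hJ, toL2_of_memLp hE, toL2_of_memLp (hJ.const_mul _)]
      rfl
    have hnn : ‖toL2 c (fun p => (k n : ℂ) * ecfProduct P X Y n w p) -
        ((k n * (sampleMean X n w * sampleMean Y n w) : ℝ) : ℂ) • G‖ =
        r⁻¹ * (eLpNorm (fun p : ℝ × ℝ => ecfProduct P X Y n w p -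
          J₁ p.1 * (sampleMean X n w : ℂ) * (J₁ p.2 * (sampleMean Y n w : ℂ))) 2
          (weightMeasure c)).toReal := by
      rw [hdiff, norm_smul, Lp.norm_toLp, hfun, Complex.norm_real, hkn,
        Real.norm_of_nonneg (by positivity)]
    simp only [Set.mem_ofPred_eq, Pi.sub_apply, Pi.zero_apply, sub_zero]
    rw [hnn, ENNReal.ofReal_le_iff_le_toReal (by rw [hfun]; exact hS.2.ne),
      ← div_eq_inv_mul, le_div_iff₀ hr]
  · rcases Nat.eq_zero_or_pos n with rfl | hn
    · -- for `n = 0` the empirical characteristic functions are `0 / 0 = 0` for every outcome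
      simp only [ecfProduct, empCharFun, Finset.range_zero, Finset.sum_empty]
      exact aemeasurable_const
    · have h := (aemeasurable_toL2_ecfProduct hc hX hY hn).const_smul (k n : ℂ)
      refine h.congr (ae_of_all _ fun w => ?_)
      exact (toL2_const_mul (memLp_ecfProduct hc hX hY hn w) _).symm

end TimeSeries

end DistCov

theorem mainTheorem7 {Ω : Type*} [MeasurableSpace Ω] (P : Measure Ω) [IsProbabilityMeasure P]
    {Ω' : Type*} [MeasurableSpace Ω'] (P' : Measure Ω') [IsProbabilityMeasure P']
    (c : ℝ) (hc : 0 < c)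
    (X Y : ℕ → Ω → ℝ) (D_X D_Y : ℝ) (L_X L_Y : ℝ → ℝ)
    (hX : DistCov.IsStandardLRDGaussian P X D_X L_X)
    (hY : DistCov.IsStandardLRDGaussian P Y D_Y L_Y)
    (hXY : IndepFun (fun w k => X k w) (fun w k => Y k w) P)
    (Z_X Z_Y : Ω' → ℝ)
    (hZX : HasLaw Z_X (gaussianReal 0 1) P') (hZY : HasLaw Z_Y (gaussianReal 0 1) P')
    (hZ : IndepFun Z_X Z_Y P') :
    -- all functions involved are elements of `L²(ω)`
    (∀ n : ℕ, 1 ≤ n → ∀ w, MemLp (DistCov.ecfProduct P X Y n w) 2 (DistCov.weightMeasure c)) ∧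
    MemLp (fun p : ℝ × ℝ => DistCov.J₁ p.1 * DistCov.J₁ p.2) 2 (DistCov.weightMeasure c) ∧
    -- the reduction
    DistCov.IsLittleOP P
      (fun n w => eLpNorm
        (fun p : ℝ × ℝ => DistCov.ecfProduct P X Y n w p -
          DistCov.J₁ p.1 * (DistCov.sampleMean X n w : ℂ) *
            (DistCov.J₁ p.2 * (DistCov.sampleMean Y n w : ℂ)))
        2 (DistCov.weightMeasure c))
      (fun n => (n : ℝ) ^ (-((D_X + D_Y) / 2)) *
        L_X n ^ (1 / 2 : ℝ) * L_Y n ^ (1 / 2 : ℝ)) ∧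
    -- weak convergence in `L²(ω)`
    TendstoInDistribution
      (fun (n : ℕ) w => DistCov.toL2 c (fun p : ℝ × ℝ =>
        (((n : ℝ) ^ ((D_X + D_Y) / 2) *
          L_X n ^ (-(1 / 2) : ℝ) * L_Y n ^ (-(1 / 2) : ℝ) : ℝ) : ℂ) *
            DistCov.ecfProduct P X Y n w p))
      atTop
      (fun w' => DistCov.toL2 c (fun p : ℝ × ℝ =>
        ((-(p.1 * p.2 * Real.exp (-(p.1 ^ 2 + p.2 ^ 2) / 2)) *
          ((Real.sqrt (DistCov.limitVar D_X) * Z_X w') *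
            (Real.sqrt (DistCov.limitVar D_Y) * Z_Y w')) : ℝ) : ℂ)))
      (fun _ => P) P' :=
  ⟨fun _ hn w => DistCov.memLp_ecfProduct hc hX hY hn w, DistCov.memLp_J₁_tensor hc,
    DistCov.isLittleOP_ecfProduct_sub hc hX hY,
    DistCov.tendstoInDistribution_ecfProduct hc hX hY hXY hZX hZY hZ⟩
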